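/- Let $1\le p<\infty$ and let $\ell_p(\mathbb Z)$ be the Banach space of $p$-summable complex sequences indexed by $\mathbb Z$, with canonical basis $(e_n)_{n\in\mathbb Z}$. A bilateral weighted shift on $\ell_p(\mathbb Z)$ is a bounded linear operator $T$ on $\ell_p(\mathbb Z)$ with $Te_n=w_ne_{n-1}$ for all $n\in\mathbb Z$, where $(w_n)_{n\in\mathbb Z}$ is a bounded sequence in $\mathbb C\setminus\{0\}$. A bounded linear operator $T$ on a complex Banach space $\mathcal B$ is called hypercyclic (respectively weakly hypercyclic) if there is $x\in\mathcal B$ whose orbit $\{T^nx : n\ge 0\}$ is dense in $\mathcal B$ in the norm topology (respectively in the weak topology); it is called supercyclic (respectively weakly supercyclic) if there is $x\in\mathcal B$ whose projective orbit $\{\lambda T^nx : n\ge 0,\ \lambda\in\mathbb C\}$ is dense in $\mathcal B$ in the norm topology (respectively in the weak topology). Then: 1. every weakly hypercyclic bilateral weighted shift on $\ell_p(\mathbb Z)$ is hypercyclic if and only if $p<2$; 2. every weakly supercyclic bilateral weighted shift on $\ell_p(\mathbb Z)$ is supercyclic if and only if $p\le 2$. Here, for each fixed $p$, the "if and only if"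 is between the universally quantified assertion about all such shifts on $\ell_p(\mathbb Z)$ and the condition on $p$. -/

import Mathlib

open scoped ENNReal

namespace LinearDynamics

section Cyclicity

variable {E : Type*} [NormedAddCommGroup E] [NormedSpace ℂ E]

/-- The orbit `O(T, x) = {T ^ n x : n = 0, 1, 2, …}`. -/
def orbit (T : E →L[ℂ] E) (x : E) : Set E :=
  {y | ∃ n : ℕ, y = (T ^ n) x}

/-- The projective orbit `{c • T ^ n x : n = 0, 1, 2, …, c ∈ ℂ}`. -/
def projOrbit (T : E →L[ℂ] E) (x : E) : Set E :=
  {y | ∃ (n : ℕ) (c : ℂ), y = c • (T ^ n) x}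

/-- A set is weakly dense if it is dense in `E` carrying its weak topology. -/
def WeaklyDense (A : Set E) : Prop :=
  Dense (toWeakSpace ℂ E '' A)

/-- Some orbit is norm dense. -/
def Hypercyclic (T : E →L[ℂ] E) : Prop :=
  ∃ x : E, Dense (orbit T x)

/-- Some projective orbit is norm dense. -/
def Supercyclic (T : E →L[ℂ] E) : Prop :=
  ∃ x : E, Dense (projOrbit T x)

/-- Some orbit is weakly dense. -/
def WeaklyHypercyclic (T : E →L[ℂ] E) : Prop :=
  ∃ x : E, WeaklyDense (orbit T x)

/-- Some projective orbit is weakly dense. -/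
def WeaklySupercyclic (T : E →L[ℂ] E) : Prop :=
  ∃ x : E, WeaklyDense (projOrbit T x)

end Cyclicity

/-- `T` is a bilateral weighted shift on the complex space `ℓ_p(ℤ)`: there is a bounded sequence
`w` of nonzero complex weights such that `T e_n = w_n e_{n-1}` on the canonical basis. For
`1 ≤ p < ∞` the finitely supported sequences are dense, so this determines the bounded linear
operator `T` from `w`. -/
def IsBilateralWeightedShift {p : ℝ≥0∞} [Fact (1 ≤ p)]
    (T : lp (fun _ : ℤ => ℂ) p →L[ℂ] lp (fun _ : ℤ => ℂ) p) : Prop :=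
  ∃ w : ℤ → ℂ, (∀ n, w n ≠ 0) ∧ (∃ C : ℝ, ∀ n, ‖w n‖ ≤ C) ∧
    ∀ n : ℤ, T (lp.single p n (1 : ℂ)) = w n • lp.single p (n - 1) (1 : ℂ)

end LinearDynamics

/-! Rescaling the basis by a potential `β` makes the shift send `β n • e_n` to `β (n - 1) •
e_{n-1}`, so that `(T ^ n x)_k = β_k x_{k+n} / β_{k+n}`. By Salas' criteria `T` is hypercyclic once
`|β (q + n)|` and `|β (q - n)|` can be made small together for every `q`, and supercyclic once their
product can.

Positive results: if the criterion fails at some `q`, pick a target `u` and consider the errors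
`y_n` (orbit vector, rescaled in the supercyclic case, minus `u`) at the times when coordinate `q`
does not already exclude closeness to `u`. Viewed as functionals on a suitable `ℓ_t` with `t ≥ 2`,
they satisfy `∑ ‖y_n‖⁻² < ∞`. A plank theorem, `QuadraticallySmooth.exists_dual_one_le`, then yields
one functional of modulus at least one on all `y_n`, which contradicts weak density at `u`. In the
supercyclic case a single coordinate of `y_n` has size about `1 / |x_{q+n}|`, and `x ∈ ℓ_2` because
`p ≤ 2`. In the hypercyclic case a counting argument shows that the number `N_n` of large
coordinates of `y_n` grows linearly after sorting; the `ℓ_r` norm is then at least of order `N_n ^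
(1/r)`, and `p < 2` leaves room for `r < 2`.

Counterexamples: the unweighted shift for `p > 2`, and for `p ≥ 2` the shift with weights `1` and
`2` on the two half lines. Their weak cyclicity follows from a Baire argument in which weak
approximation is certified by finite combinations of errors that are small, uniformly in the phases,
compared with the sum of their coefficients. The harmonic series provides the coefficients. -/

namespace LinearDynamics

/-! ### Jensen's formula for affine functions on circles. -/

section CircleAverage

open Real Metric

theorem circleAverage_log_norm_affine {a b : ℂ} {ρ : ℝ} (hρ : 0 < ρ) (hb : b ≠ 0)
    (hz : ∀ ζ : ℂ, ‖ζ‖ = ρ → a + ζ * b ≠ 0) :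
    circleAverage (fun ζ : ℂ => log ‖a + ζ * b‖) 0 ρ =
      log ‖b‖ + (log ρ + log⁺ (ρ⁻¹ * (‖a‖ / ‖b‖))) := by
  have key := circleAverage_log_norm_sub_const_eq_log_radius_add_posLog (a := -(a / b)) (c := 0)
    hρ.ne'
  have h1 : circleAverage (fun ζ : ℂ => log ‖a + ζ * b‖) 0 ρ =
      circleAverage (fun ζ : ℂ => log ‖b‖ + log ‖ζ - -(a / b)‖) 0 ρ := by
    apply circleAverage_congr_sphere
    intro ζ hζ
    have hζ' : ‖ζ‖ = ρ := by simpa [abs_of_pos hρ] using hζ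
    have e : a + ζ * b = b * (ζ - -(a / b)) := by field_simp; ring
    have hne := hz ζ hζ'
    rw [e] at hne
    simp only [e, norm_mul]
    rw [log_mul (by simpa using hb) (by simpa using right_ne_zero_of_mul hne)]
  rw [h1, circleAverage_fun_add (circleIntegrable_const _ _ _)
    (circleIntegrable_log_norm_sub_const ρ), circleAverage_const, key]
  simp

/-- Subharmonicity of `log |a + ζ b|`: moving along a complex line costs nothing on average. -/
theorem log_norm_le_circleAverage {a b : ℂ} {ρ : ℝ} (hρ : 0 < ρ) (ha : a ≠ 0)
    (hz : ∀ ζ : ℂ, ‖ζ‖ = ρ → a + ζ * b ≠ 0) :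
    log ‖a‖ ≤ circleAverage (fun ζ : ℂ => log ‖a + ζ * b‖) 0 ρ := by
  rcases eq_or_ne b 0 with rfl | hb
  · simp [circleAverage_const]
  · rw [circleAverage_log_norm_affine hρ hb hz]
    have h : log (ρ⁻¹ * (‖a‖ / ‖b‖)) ≤ log⁺ (ρ⁻¹ * (‖a‖ / ‖b‖)) := le_max_right _ _
    have ha' := norm_pos_iff.2 ha
    have hb' := norm_pos_iff.2 hb
    rw [log_mul (by positivity) (by positivity), log_div ha'.ne' hb'.ne', log_inv] at h
    linarith

/-- The gain in the plank theorem: a perturbation of radius `ρ` reaches size `ρ ‖b‖` on average,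
however small `a` is. -/
theorem log_mul_norm_le_circleAverage {a b : ℂ} {ρ : ℝ} (hρ : 0 < ρ) (hb : b ≠ 0)
    (hz : ∀ ζ : ℂ, ‖ζ‖ = ρ → a + ζ * b ≠ 0) :
    log (ρ * ‖b‖) ≤ circleAverage (fun ζ : ℂ => log ‖a + ζ * b‖) 0 ρ := by
  rw [circleAverage_log_norm_affine hρ hb hz, log_mul hρ.ne' (by simpa using hb)]
  have : 0 ≤ log⁺ (ρ⁻¹ * (‖a‖ / ‖b‖)) := posLog_nonneg
  linarith

theorem circleIntegrable_log_norm_affine (a b : ℂ) (ρ : ℝ) :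
    CircleIntegrable (fun ζ : ℂ => log ‖a + ζ * b‖) 0 ρ :=
  MeromorphicOn.circleIntegrable_log_norm (f := fun ζ : ℂ => a + ζ * b) (fun _ _ => by fun_prop)

theorem circleAverage_re_mul (ℓ : ℂ) (ρ : ℝ) :
    circleAverage (fun ζ : ℂ => (ζ * ℓ).re) 0 ρ = 0 := by
  have h : circleAverage (fun ζ : ℂ => ζ * ℓ) 0 ρ = 0 := by
    have := DiffContOnCl.circleAverage (f := fun ζ : ℂ => ζ * ℓ) (c := 0) (R := ρ)
      (Differentiable.diffContOnCl (by fun_prop))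
    simpa using this
  have hi : CircleIntegrable (fun ζ : ℂ => ζ * ℓ) 0 ρ :=
    (Continuous.continuousOn (by fun_prop)).circleIntegrable'
  have := ContinuousLinearMap.circleAverage_comp_comm Complex.reCLM hi
  rw [h] at this
  simpa [Function.comp_def] using this

end CircleAverage

/-! ### A plank theorem for quadratically smooth complex spaces. -/

section Plank

variable {Y : Type*} [NormedAddCommGroup Y] [NormedSpace ℂ Y]

/-- A complex form of uniform smoothness of power type two: along every complex line through a unit
vector the norm is dominated by the exponential of a harmonic function plus a quadratic term. -/
def QuadraticallySmooth (Y : Type*) [NormedAddCommGroup Y] [NormedSpace ℂ Y] (C : ℝ) : Prop :=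
  ∀ g u : Y, ‖g‖ = 1 → ‖u‖ ≤ 1 → ∃ ℓ : ℂ, ∀ ζ : ℂ, ‖ζ‖ ≤ 1 →
    ‖g + ζ • u‖ ≤ Real.exp ((ζ * ℓ).re + C * ‖ζ‖ ^ 2)

/-- A complex vector space is not a finite union of proper subspaces, here kernels. -/
theorem exists_forall_apply_ne_zero {ι : Type*} (F : Finset ι) (φ : ι → (Y →L[ℂ] ℂ))
    (hφ : ∀ k ∈ F, φ k ≠ 0) : ∃ g : Y, ∀ k ∈ F, φ k g ≠ 0 := by
  classical
  have hne : (⋃ p ∈ F.image fun k => LinearMap.ker (φ k).toLinearMap, (p : Set Y)) ≠ Set.univ := by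
    apply Subspace.biUnion_ne_univ_of_top_notMem
    intro h
    obtain ⟨k, hk, h⟩ := Finset.mem_image.1 h
    apply hφ k hk
    ext y
    exact LinearMap.congr_fun (LinearMap.ker_eq_top.1 h) y
  obtain ⟨g, hg⟩ := (Set.ne_univ_iff_exists_notMem _).1 hne
  refine ⟨g, fun k hk h0 => hg ?_⟩
  simp only [Set.mem_iUnion]
  exact ⟨_, Finset.mem_image_of_mem _ hk, h0⟩

open Real in
/-- Approximate maximizers of `∏ |φ k g| ^ s k` on the unit sphere. -/
theorem exists_almost_maximizer {ι : Type*} (F : Finset ι) (hF : F.Nonempty)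
    (φ : ι → (Y →L[ℂ] ℂ)) (hφ : ∀ k ∈ F, φ k ≠ 0) (s : ι → ℝ) (hs : ∀ k ∈ F, 0 < s k)
    {δ : ℝ} (hδ : 0 < δ) :
    ∃ g : Y, ‖g‖ = 1 ∧ (∀ k ∈ F, φ k g ≠ 0) ∧ ∀ h : Y, (∀ k ∈ F, φ k h ≠ 0) →
      ∑ k ∈ F, s k * log ‖φ k h‖ ≤
        ∑ k ∈ F, s k * log ‖φ k g‖ + δ + (∑ k ∈ F, s k) * log ‖h‖ := by
  let S : Set ℝ := {r | ∃ g : Y, ‖g‖ = 1 ∧ (∀ k ∈ F, φ k g ≠ 0) ∧ r = ∑ k ∈ F, s k * log ‖φ k g‖}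
  have ne0 : ∀ h : Y, (∀ k ∈ F, φ k h ≠ 0) → h ≠ 0 := by
    rintro h hh rfl
    obtain ⟨k, hk⟩ := hF
    exact hh k hk (map_zero _)
  -- The product is homogeneous of degree `∑ s k`, so normalising `h` costs exactly that multiple of
  -- `log ‖h‖`.
  have hmem : ∀ h : Y, (∀ k ∈ F, φ k h ≠ 0) →
      ∑ k ∈ F, s k * log ‖φ k h‖ - (∑ k ∈ F, s k) * log ‖h‖ ∈ S := by
    intro h hh
    have h0 := norm_pos_iff.2 (ne0 h hh)
    refine ⟨((‖h‖⁻¹ : ℝ) : ℂ) • h, ?_, ?_, ?_⟩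
    · rw [norm_smul, Complex.norm_real, norm_inv, norm_norm, inv_mul_cancel₀ h0.ne']
    · intro k hk
      rw [map_smul]
      exact smul_ne_zero (by simpa using ne0 h hh) (hh k hk)
    · rw [Finset.sum_mul, ← Finset.sum_sub_distrib]
      refine Finset.sum_congr rfl fun k hk => ?_
      rw [map_smul, norm_smul, Complex.norm_real, norm_inv, norm_norm,
        log_mul (inv_ne_zero h0.ne') (by simpa using hh k hk), log_inv]
      ring
  obtain ⟨g₀, hg₀⟩ := exists_forall_apply_ne_zero F φ hφ
  have hSne : S.Nonempty := ⟨_, hmem g₀ hg₀⟩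
  have hSb : BddAbove S := by
    refine ⟨∑ k ∈ F, s k * log ‖φ k‖, ?_⟩
    rintro r ⟨g, hg, hgn, rfl⟩
    refine Finset.sum_le_sum fun k hk => mul_le_mul_of_nonneg_left ?_ (hs k hk).le
    refine log_le_log (norm_pos_iff.2 (hgn k hk)) ?_
    simpa [hg] using (φ k).le_opNorm g
  obtain ⟨r, ⟨g, hg, hgn, rfl⟩, hr⟩ := exists_lt_of_lt_csSup hSne (sub_lt_self (sSup S) hδ)
  refine ⟨g, hg, hgn, fun h hh => ?_⟩
  have := le_csSup hSb (hmem h hh)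
  linarith

open Real in
/-- A plank theorem for finitely many functionals on a quadratically smooth space. -/
theorem QuadraticallySmooth.exists_finite_plank {C : ℝ} (hC : 0 ≤ C)
    (hY : QuadraticallySmooth Y C) {ι : Type*} (F : Finset ι) (φ : ι → (Y →L[ℂ] ℂ))
    (hφ : ∀ k ∈ F, φ k ≠ 0) (s : ι → ℝ) (hs : ∀ k ∈ F, 0 < s k) (hsum : ∑ k ∈ F, s k ≤ 1) :
    ∃ g : Y, ‖g‖ ≤ 1 ∧ ∀ k ∈ F, exp (-(1 + C)) / 4 * (√(s k) * ‖φ k‖) ≤ ‖φ k g‖ := by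
  classical
  rcases F.eq_empty_or_nonempty with rfl | hF
  · exact ⟨0, by simp, by simp⟩
  -- The slack in the maximisation is the least weight, so it can be absorbed into `s j` whichever
  -- `j` is examined.
  obtain ⟨j₀, hj₀, hmin⟩ := F.exists_min_image s hF
  obtain ⟨g, hg, hgn, hmax⟩ := exists_almost_maximizer F hF φ hφ s hs (hs j₀ hj₀)
  refine ⟨g, hg.le, fun j hj => ?_⟩
  have hsj := hs j hj
  have hsj1 : s j ≤ 1 :=
    (Finset.single_le_sum (fun k hk => (hs k hk).le) hj).trans hsum
  have hφj : 0 < ‖φ j‖ := norm_pos_iff.2 (hφ j hj)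
  obtain ⟨u, hu, huj⟩ : ∃ u : Y, ‖u‖ ≤ 1 ∧ ‖φ j‖ / 2 < ‖φ j u‖ := by
    obtain ⟨x, hx, hxr⟩ := (φ j).exists_lt_apply_of_lt_opNorm (half_lt_self hφj)
    exact ⟨x, hx.le, hxr⟩
  -- A radius of order `√(s j)` keeps the quadratic loss `C * ρ ^ 2` below `C * s j`; the excluded
  -- radii are those on which some `φ k (g + ζ • u)` could vanish.
  obtain ⟨ρ, hρ, hρF⟩ := (Set.Ioo_infinite (half_lt_self (sqrt_pos.2 hsj))).exists_notMem_finset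
    (F.image fun k => ‖φ k g‖ / ‖φ k u‖)
  have hρ0 : 0 < ρ := lt_trans (by positivity) hρ.1
  have hρ2 : ρ ^ 2 ≤ s j := by
    rw [← sq_sqrt hsj.le]
    exact pow_le_pow_left₀ hρ0.le hρ.2.le 2
  have hρ1 : ρ ≤ 1 := hρ.2.le.trans (by rw [sqrt_le_iff]; exact ⟨zero_le_one, by simpa using hsj1⟩)
  have hz : ∀ k ∈ F, ∀ ζ : ℂ, ‖ζ‖ = ρ → φ k g + ζ * φ k u ≠ 0 := by
    intro k hk ζ hζ h0
    rcases eq_or_ne (φ k u) 0 with hu0 | hu0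
    · rw [hu0, mul_zero, add_zero] at h0
      exact hgn k hk h0
    · apply hρF
      refine Finset.mem_image.2 ⟨k, hk, ?_⟩
      have : φ k g = -(ζ * φ k u) := by linear_combination h0
      rw [this, norm_neg, norm_mul, hζ, mul_div_cancel_right₀ _ (norm_ne_zero_iff.2 hu0)]
  obtain ⟨ℓ, hℓ⟩ := hY g u hg hu
  set σ := ∑ k ∈ F, s k with hσ
  have hσ0 : 0 ≤ σ := Finset.sum_nonneg fun k hk => (hs k hk).le
  have hpt : ∀ ζ ∈ Metric.sphere (0 : ℂ) |ρ|, ∑ k ∈ F, s k * log ‖φ k g + ζ * φ k u‖ ≤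
      (∑ k ∈ F, s k * log ‖φ k g‖ + s j₀ + C * ρ ^ 2) + σ * (ζ * ℓ).re := by
    intro ζ hζ
    have hζ' : ‖ζ‖ = ρ := by simpa [abs_of_pos hρ0] using hζ
    have hk : ∀ k ∈ F, φ k (g + ζ • u) ≠ 0 := by
      intro k hk
      simpa using hz k hk ζ hζ'
    have h1 := hmax _ hk
    have h0 : 0 < ‖g + ζ • u‖ := by
      apply norm_pos_iff.2
      intro h
      exact hk j hj (by rw [h, map_zero])
    have h2 : log ‖g + ζ • u‖ ≤ (ζ * ℓ).re + C * ρ ^ 2 := by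
      rw [log_le_iff_le_exp h0, ← hζ']
      exact hℓ ζ (hζ'.le.trans hρ1)
    have h3 : σ * (C * ρ ^ 2) ≤ 1 * (C * ρ ^ 2) := by gcongr
    have h4 := mul_le_mul_of_nonneg_left h2 hσ0
    simp only [map_add, map_smul, smul_eq_mul] at h1
    linarith
  have hint : ∀ k ∈ F, CircleIntegrable (fun ζ : ℂ => s k * log ‖φ k g + ζ * φ k u‖) 0 ρ :=
    fun k _ => (circleIntegrable_log_norm_affine (φ k g) (φ k u) ρ).const_smul (a := s k)
  have hRe : CircleIntegrable (fun ζ : ℂ => σ * (ζ * ℓ).re) 0 ρ :=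
    (Continuous.continuousOn (by fun_prop)).circleIntegrable'
  have hRe0 : circleAverage (fun ζ : ℂ => σ * (ζ * ℓ).re) 0 ρ = 0 := by
    have := circleAverage_re_mul (σ * ℓ) ρ
    convert this using 2
    ext ζ
    rw [mul_left_comm, Complex.re_ofReal_mul]
  -- Averaging removes the linear term; the factors `k ≠ j` do not decrease, so factor `j` alone
  -- must pay for the gain.
  have havg := circleAverage_mono (CircleIntegrable.fun_sum F hint)
    ((circleIntegrable_const _ _ _).add hRe) hpt
  rw [circleAverage_fun_sum hint, circleAverage_add (circleIntegrable_const _ _ _) hRe,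
    circleAverage_const, hRe0, add_zero, ← Finset.add_sum_erase _ _ hj,
    ← Finset.add_sum_erase _ _ hj] at havg
  have hmul : ∀ k, circleAverage (fun ζ : ℂ => s k * log ‖φ k g + ζ * φ k u‖) 0 ρ =
      s k * circleAverage (fun ζ : ℂ => log ‖φ k g + ζ * φ k u‖) 0 ρ := by
    intro k
    simpa using circleAverage_fun_smul (a := s k) (c := 0) (R := ρ)
      (f := fun ζ : ℂ => log ‖φ k g + ζ * φ k u‖)
  simp only [hmul] at havg
  have hrest : ∑ k ∈ F.erase j, s k * log ‖φ k g‖ ≤ ∑ k ∈ F.erase j,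
      s k * circleAverage (fun ζ : ℂ => log ‖φ k g + ζ * φ k u‖) 0 ρ := by
    refine Finset.sum_le_sum fun k hk => mul_le_mul_of_nonneg_left ?_ ?_
    · have := Finset.mem_of_mem_erase hk
      exact log_norm_le_circleAverage hρ0 (hgn k this) (hz k this)
    · exact (hs k (Finset.mem_of_mem_erase hk)).le
  have hu0 : φ j u ≠ 0 := norm_pos_iff.1 (lt_trans (by positivity) huj)
  have hmain := mul_le_mul_of_nonneg_left (log_mul_norm_le_circleAverage hρ0 hu0 (hz j hj)) hsj.le
  have h5 : s j * log (ρ * ‖φ j u‖) ≤ s j * (log ‖φ j g‖ + (1 + C)) := by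
    have := hmin j hj
    have := mul_le_mul_of_nonneg_left hρ2 hC
    linarith
  have h6 : ρ * ‖φ j u‖ ≤ ‖φ j g‖ * exp (1 + C) := by
    have hp : 0 < ρ * ‖φ j u‖ := mul_pos hρ0 (norm_pos_iff.2 hu0)
    have h := le_of_mul_le_mul_left h5 hsj
    have hg0 := norm_pos_iff.2 (hgn j hj)
    rw [← log_exp (1 + C), ← log_mul hg0.ne' (exp_pos _).ne'] at h
    exact (log_le_log_iff hp (by positivity)).1 h
  have h7 : √(s j) / 2 * (‖φ j‖ / 2) ≤ ρ * ‖φ j u‖ := by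
    have := hρ.1.le
    gcongr
  rw [exp_neg]
  rw [show (exp (1 + C))⁻¹ / 4 * (√(s j) * ‖φ j‖) = (√(s j) / 2 * (‖φ j‖ / 2)) / exp (1 + C) by
    field_simp; norm_num, div_le_iff₀ (exp_pos _)]
  exact h7.trans h6

open Real in
/-- If `Λ` maps a quadratically smooth space into the dual of `X` and the functionals induced by the
vectors `y k` have square-summable inverse norms, then some functional on `X` is at least one in
modulus on every `y k`; in particular `0` is not in the weak closure of the `y k`. -/
theorem QuadraticallySmooth.exists_dual_one_le {C : ℝ} (hC : 0 ≤ C)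
    (hY : QuadraticallySmooth Y C) {X : Type*} [NormedAddCommGroup X] [NormedSpace ℂ X]
    (Λ : Y →L[ℂ] (X →L[ℂ] ℂ)) {ι : Type*} (y : ι → X) (hy : ∀ k, Λ.flip (y k) ≠ 0)
    (hsum : Summable fun k => (‖Λ.flip (y k)‖ ^ 2)⁻¹) :
    ∃ ψ : X →L[ℂ] ℂ, ∀ k, 1 ≤ ‖ψ (y k)‖ := by
  set φ : ι → (Y →L[ℂ] ℂ) := fun k => Λ.flip (y k) with hφ
  set S := ∑' k, (‖φ k‖ ^ 2)⁻¹ + 1 with hS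
  have hS0 : 0 < S := by
    have : 0 ≤ ∑' k, (‖φ k‖ ^ 2)⁻¹ := tsum_nonneg fun k => by positivity
    linarith
  set κ := exp (-(1 + C)) / 4 / √S with hκ
  have hκ0 : 0 < κ := by positivity
  -- With weights `‖φ k‖⁻² / S` the plank bound `√(s k) * ‖φ k‖` does not depend on `k`, so one
  -- rescaling by `κ⁻¹` suffices.
  have hfin : ∀ F : Finset ι, ∃ g : Y, ‖g‖ ≤ κ⁻¹ ∧ ∀ k ∈ F, 1 ≤ ‖φ k g‖ := by
    intro F
    have hpos : ∀ k, 0 < ‖φ k‖ := fun k => norm_pos_iff.2 (hy k)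
    obtain ⟨g, hg, hgF⟩ := hY.exists_finite_plank hC F φ (fun k _ => hy k)
      (fun k => (‖φ k‖ ^ 2)⁻¹ / S) (fun k _ => by have := hpos k; positivity)
      (by
        rw [← Finset.sum_div, div_le_one hS0]
        have := hsum.sum_le_tsum F (fun k _ => by positivity)
        linarith)
    refine ⟨((κ⁻¹ : ℝ) : ℂ) • g, ?_, fun k hk => ?_⟩
    · rw [norm_smul, Complex.norm_real, norm_of_nonneg (by positivity)]
      exact mul_le_of_le_one_right (by positivity) hg
    · have h := hgF k hk
      have hk0 := hpos k
      rw [sqrt_div (by positivity), sqrt_inv, sqrt_sq hk0.le, div_mul_eq_mul_div (‖φ k‖⁻¹),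
        inv_mul_cancel₀ hk0.ne', mul_one_div] at h
      rw [map_smul, norm_smul, Complex.norm_real, norm_of_nonneg (by positivity),
        inv_mul_eq_div, one_le_div hκ0]
      exact h
  set R := ‖Λ‖ * κ⁻¹
  -- Banach–Alaoglu passes from finite sets of vectors to all of them, since `R` is uniform in `F`.
  have hcomp := WeakDual.isCompact_closedBall (𝕜 := ℂ) (E := X) 0 R
  obtain ⟨ψ, -, hψ⟩ := hcomp.inter_iInter_nonempty
    (fun k => {ψ : WeakDual ℂ X | 1 ≤ ‖ψ (y k)‖})
    (fun k => isClosed_le continuous_const (WeakDual.eval_continuous (y k)).norm)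
    (fun F => by
      obtain ⟨g, hg, hgF⟩ := hfin F
      refine ⟨StrongDual.toWeakDual (Λ g), ?_, ?_⟩
      · simp only [Set.mem_preimage, mem_closedBall_zero_iff]
        exact (Λ.le_opNorm g).trans (mul_le_mul_of_nonneg_left hg (norm_nonneg _))
      · simp only [Set.mem_iInter]
        intro k hk
        exact hgF k hk)
  refine ⟨WeakDual.toStrongDual ψ, fun k => ?_⟩
  exact Set.mem_iInter.1 hψ k

end Plank

end LinearDynamics

namespace LinearDynamics

/-! ### Quadratic smoothness of `ℓ_t` for `2 ≤ t < ∞`. -/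

section Smooth

open Real

theorem exp_le_one_add_add_sq_mul_exp {y M : ℝ} (hM : |y| ≤ M) :
    exp y ≤ 1 + y + y ^ 2 * exp M := by
  have h1 : 1 - y ≤ exp (-y) := by linarith [add_one_le_exp (-y)]
  have h2 : exp y * exp (-y) = 1 := by rw [← exp_add]; simp
  have hpos := exp_pos y
  have h3 : exp y ≤ 1 + y * exp y := by nlinarith
  have hyM : exp y ≤ exp M := exp_le_exp.2 ((le_abs_self y).trans hM)
  have hM1 : 1 ≤ exp M := one_le_exp ((abs_nonneg y).trans hM)
  rcases le_total 0 y with hy | hy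
  · nlinarith [mul_le_mul_of_nonneg_left h3 hy, mul_le_mul_of_nonneg_left hyM (sq_nonneg y)]
  · nlinarith [add_one_le_exp y, mul_le_mul_of_nonneg_left hM1 (sq_nonneg y)]

/-- Write `‖1 + z‖ ^ 2 = 1 + h`, bound `(1 + h) ^ (t / 2)` by `exp (t h / 2)`, and expand to second
order. -/
theorem norm_one_add_rpow_le {t : ℝ} (ht : 2 ≤ t) {z : ℂ} (hz : ‖z‖ ≤ 1) :
    ‖1 + z‖ ^ t ≤ 1 + t * z.re + (t + 9 * t ^ 2 * exp (3 * t)) * ‖z‖ ^ 2 := by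
  have hsq : ‖1 + z‖ ^ 2 = 1 + (2 * z.re + ‖z‖ ^ 2) := by
    rw [← Complex.normSq_eq_norm_sq, ← Complex.normSq_eq_norm_sq, Complex.normSq_apply,
      Complex.normSq_apply]
    simp
    ring
  set h := 2 * z.re + ‖z‖ ^ 2 with hh
  have hre : |z.re| ≤ ‖z‖ := Complex.abs_re_le_norm z
  have hz0 := norm_nonneg z
  have habs : |h| ≤ 3 * ‖z‖ := by
    rw [abs_le] at hre ⊢
    constructor <;> nlinarith
  have h1 : ‖1 + z‖ ^ t ≤ exp (t / 2 * h) := by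
    have e : ‖1 + z‖ ^ t = (‖1 + z‖ ^ 2) ^ (t / 2) := by
      rw [← rpow_natCast, ← rpow_mul (norm_nonneg _)]
      congr 1
      push_cast
      ring
    rw [e, mul_comm, exp_mul]
    refine rpow_le_rpow (by positivity) ?_ (by positivity)
    rw [hsq, add_comm]
    exact add_one_le_exp h
  have h2 : |t / 2 * h| ≤ 3 * t := by
    rw [abs_mul, abs_of_nonneg (by positivity)]
    nlinarith
  have h3 := exp_le_one_add_add_sq_mul_exp h2
  have h4 : h ^ 2 ≤ 9 * ‖z‖ ^ 2 := by
    rw [← sq_abs h]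
    nlinarith [abs_nonneg h]
  have h5 : (t / 2 * h) ^ 2 * exp (3 * t) ≤ 9 * t ^ 2 * exp (3 * t) * ‖z‖ ^ 2 := by
    have : (t / 2 * h) ^ 2 ≤ 9 * t ^ 2 * ‖z‖ ^ 2 := by
      nlinarith [mul_le_mul_of_nonneg_left h4 (sq_nonneg t), sq_nonneg (t * ‖z‖)]
    nlinarith [mul_le_mul_of_nonneg_right this (exp_pos (3 * t)).le]
  have h6 : t / 2 * h ≤ t * z.re + t * ‖z‖ ^ 2 := by
    rw [hh]
    nlinarith [sq_nonneg ‖z‖]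
  linarith

/-- The linear term is the derivative of `‖·‖ ^ t` at `a`. If `‖a‖ ≤ ‖ζ b‖`, every term is of order
`‖ζ‖ ^ t ‖b‖ ^ t`, and `t ≥ 2` gives `‖ζ‖ ^ t ≤ ‖ζ‖ ^ 2`; otherwise divide by `a` and use
`norm_one_add_rpow_le`. -/
theorem exists_norm_add_mul_rpow_le {t : ℝ} (ht : 2 ≤ t) :
    ∃ C : ℝ, 0 ≤ C ∧ ∀ a b ζ : ℂ, ‖ζ‖ ≤ 1 →
      ‖a + ζ * b‖ ^ t ≤ ‖a‖ ^ t +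
        (ζ * (((t * ‖a‖ ^ (t - 2) : ℝ) : ℂ) * (b * (starRingEnd ℂ) a))).re +
        C * ‖ζ‖ ^ 2 * (‖a‖ ^ t + ‖b‖ ^ t) := by
  set K := t + 9 * t ^ 2 * exp (3 * t) with hK
  have hK0 : 0 ≤ K := by positivity
  refine ⟨K + 2 ^ t + t, by positivity, fun a b ζ hζ => ?_⟩
  have hζt : ‖ζ‖ ^ t ≤ ‖ζ‖ ^ 2 := by
    rw [← rpow_natCast]
    exact rpow_le_rpow_of_exponent_ge' (norm_nonneg _) hζ (by norm_num) (by exact_mod_cast ht)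
  have ha0 := norm_nonneg a
  have hb0 := norm_nonneg b
  have hat : 0 ≤ ‖a‖ ^ t := by positivity
  have hbt : 0 ≤ ‖b‖ ^ t := by positivity
  have h2t : (0 : ℝ) ≤ 2 ^ t := by positivity
  rcases le_or_gt ‖a‖ ‖ζ * b‖ with hab | hab
  · have h1 : ‖a + ζ * b‖ ^ t ≤ 2 ^ t * (‖ζ‖ ^ 2 * ‖b‖ ^ t) := by
      calc ‖a + ζ * b‖ ^ t ≤ (2 * ‖ζ * b‖) ^ t :=
            rpow_le_rpow (norm_nonneg _) ((norm_add_le _ _).trans (by linarith)) (by linarith)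
        _ = 2 ^ t * (‖ζ‖ ^ t * ‖b‖ ^ t) := by
            rw [mul_rpow (by norm_num) (norm_nonneg _), norm_mul,
              mul_rpow (norm_nonneg _) (norm_nonneg _)]
        _ ≤ _ := by gcongr
    have h2 : |(ζ * (((t * ‖a‖ ^ (t - 2) : ℝ) : ℂ) * (b * (starRingEnd ℂ) a))).re| ≤
        t * (‖ζ‖ ^ 2 * ‖b‖ ^ t) := by
      refine (Complex.abs_re_le_norm _).trans ?_
      have e : ‖ζ * (((t * ‖a‖ ^ (t - 2) : ℝ) : ℂ) * (b * (starRingEnd ℂ) a))‖ =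
          t * (‖a‖ ^ (t - 2) * ‖a‖ * ‖ζ * b‖) := by
        rw [norm_mul, norm_mul, norm_mul, norm_mul, Complex.norm_real, RCLike.norm_conj,
          norm_of_nonneg (by positivity)]
        ring
      rw [e]
      have h3 : ‖a‖ ^ (t - 2) * ‖a‖ * ‖ζ * b‖ ≤ ‖ζ * b‖ ^ t := by
        calc ‖a‖ ^ (t - 2) * ‖a‖ * ‖ζ * b‖
            ≤ ‖ζ * b‖ ^ (t - 2) * ‖ζ * b‖ * ‖ζ * b‖ := by
              have := rpow_le_rpow ha0 hab (sub_nonneg.2 ht)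
              gcongr
          _ = ‖ζ * b‖ ^ (t - 2) * ‖ζ * b‖ ^ (2 : ℝ) := by
              rw [rpow_two]; ring
          _ = ‖ζ * b‖ ^ t := by
              rw [← rpow_add_of_nonneg (norm_nonneg _) (by linarith) (by norm_num)]
              congr 1; ring
      have h4 : ‖ζ * b‖ ^ t ≤ ‖ζ‖ ^ 2 * ‖b‖ ^ t := by
        rw [norm_mul, mul_rpow (norm_nonneg _) (norm_nonneg _)]
        gcongr
      exact mul_le_mul_of_nonneg_left (h3.trans h4) (by linarith)
    have h5 := (abs_le.1 h2).1
    have h6 : 0 ≤ ‖ζ‖ ^ 2 * ‖a‖ ^ t := by positivity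
    have h7 : 0 ≤ ‖ζ‖ ^ 2 * ‖b‖ ^ t := by positivity
    nlinarith [mul_nonneg hK0 h7, mul_nonneg hK0 h6, mul_nonneg h2t h6]
  · have ha : 0 < ‖a‖ := (norm_nonneg _).trans_lt hab
    have ha' : a ≠ 0 := norm_pos_iff.1 ha
    set z := ζ * b / a with hz
    have hz1 : ‖z‖ ≤ 1 := by
      rw [hz, norm_div, div_le_one ha]; exact hab.le
    have key := norm_one_add_rpow_le ht hz1
    have e1 : ‖a + ζ * b‖ ^ t = ‖a‖ ^ t * ‖1 + z‖ ^ t := by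
      rw [← mul_rpow ha0 (norm_nonneg _), ← norm_mul]
      congr 2
      rw [hz]; field_simp
    have esplit : ‖a‖ ^ t = ‖a‖ ^ (t - 2) * ‖a‖ ^ 2 := by
      rw [← rpow_two, ← rpow_add ha]; congr 1; ring
    have e2 : (ζ * (((t * ‖a‖ ^ (t - 2) : ℝ) : ℂ) * (b * (starRingEnd ℂ) a))).re =
        ‖a‖ ^ t * (t * z.re) := by
      have : ζ * (((t * ‖a‖ ^ (t - 2) : ℝ) : ℂ) * (b * (starRingEnd ℂ) a)) =
          ((‖a‖ ^ t * t : ℝ) : ℂ) * z := by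
        have hconj : (starRingEnd ℂ) a = ((‖a‖ ^ 2 : ℝ) : ℂ) / a := by
          rw [eq_div_iff ha', mul_comm, Complex.mul_conj, Complex.normSq_eq_norm_sq]
        rw [hconj, hz, esplit]
        push_cast
        ring
      rw [this, Complex.re_ofReal_mul]
      ring
    have e3 : ‖a‖ ^ t * ‖z‖ ^ 2 ≤ ‖ζ‖ ^ 2 * (‖a‖ ^ t + ‖b‖ ^ t) := by
      have : ‖a‖ ^ t * ‖z‖ ^ 2 = ‖ζ‖ ^ 2 * (‖a‖ ^ (t - 2) * ‖b‖ ^ 2) := by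
        rw [hz, norm_div, norm_mul, esplit]
        field_simp
      rw [this]
      gcongr
      rcases le_total ‖a‖ ‖b‖ with hle | hle
      · have : ‖a‖ ^ (t - 2) * ‖b‖ ^ 2 ≤ ‖b‖ ^ (t - 2) * ‖b‖ ^ (2 : ℝ) := by
          rw [rpow_two]
          have := rpow_le_rpow ha0 hle (sub_nonneg.2 ht)
          gcongr
        rw [← rpow_add_of_nonneg hb0 (by linarith) (by norm_num), sub_add_cancel] at this
        linarith
      · have : ‖a‖ ^ (t - 2) * ‖b‖ ^ 2 ≤ ‖a‖ ^ (t - 2) * ‖a‖ ^ 2 := by gcongr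
        rw [← esplit] at this
        linarith
    rw [e1, e2]
    have h1 := mul_le_mul_of_nonneg_left key hat
    have h2 := mul_le_mul_of_nonneg_left e3 hK0
    have h3 : 0 ≤ (2 ^ t + t) * (‖ζ‖ ^ 2 * (‖a‖ ^ t + ‖b‖ ^ t)) := by positivity
    nlinarith

/-- `ℓ_t` is quadratically smooth for `2 ≤ t < ∞`. -/
theorem exists_quadraticallySmooth_lp (t : ℝ≥0∞) [Fact (1 ≤ t)] (ht : 2 ≤ t.toReal) :
    ∃ C : ℝ, 0 ≤ C ∧ QuadraticallySmooth (lp (fun _ : ℤ => ℂ) t) C := by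
  obtain ⟨C, hC, hpt⟩ := exists_norm_add_mul_rpow_le ht
  set τ := t.toReal with hτ
  have hτ0 : 0 < τ := by linarith
  refine ⟨2 * C / τ, by positivity, fun g u hg hu => ?_⟩
  set L : ℤ → ℂ := fun i =>
    ((τ * ‖g i‖ ^ (τ - 2) : ℝ) : ℂ) * (u i * (starRingEnd ℂ) (g i)) with hL
  have hgs := lp.hasSum_norm hτ0 g
  have hus := lp.hasSum_norm hτ0 u
  have hLs : Summable L := by
    refine Summable.of_norm_bounded ((hgs.add hus).summable.mul_left τ) fun i => ?_
    rw [hL]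
    simp only [norm_mul, Complex.norm_real, RCLike.norm_conj, norm_of_nonneg hτ0.le]
    rw [norm_of_nonneg (by positivity), mul_assoc]
    gcongr
    have hm : ∀ w : ℝ, 0 ≤ w → w ^ (τ - 2) * (w * w) = w ^ τ := by
      intro w hw
      rw [← sq, ← rpow_two, ← rpow_add_of_nonneg hw (by linarith) (by norm_num), sub_add_cancel]
    have h0 := norm_nonneg (g i)
    have h0' := norm_nonneg (u i)
    rcases le_total ‖g i‖ ‖u i‖ with hle | hle
    · have := rpow_le_rpow h0 hle (sub_nonneg.2 ht)
      calc ‖g i‖ ^ (τ - 2) * (‖u i‖ * ‖g i‖) ≤ ‖u i‖ ^ (τ - 2) * (‖u i‖ * ‖u i‖) := by gcongr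
        _ = ‖u i‖ ^ τ := hm _ h0'
        _ ≤ _ := le_add_of_nonneg_left (by positivity)
    · calc ‖g i‖ ^ (τ - 2) * (‖u i‖ * ‖g i‖) ≤ ‖g i‖ ^ (τ - 2) * (‖g i‖ * ‖g i‖) := by gcongr
        _ = ‖g i‖ ^ τ := hm _ h0
        _ ≤ _ := le_add_of_nonneg_right (by positivity)
  -- Summing over coordinates bounds `‖g + ζ • u‖ ^ τ` by an exponential; taking the `τ`-th root
  -- divides the exponent by `τ`.
  refine ⟨(∑' i, L i) / τ, fun ζ hζ => ?_⟩
  have hre : HasSum (fun i => (ζ * L i).re) (ζ * ∑' i, L i).re :=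
    Complex.hasSum_re (hLs.hasSum.mul_left ζ)
  have hR := (hgs.add hre).add ((hgs.add hus).mul_left (C * ‖ζ‖ ^ 2))
  have hle := hasSum_le (fun i => hpt (g i) (u i) ζ hζ)
    (lp.hasSum_norm hτ0 (g + ζ • u)) hR
  have hu' : ‖u‖ ^ τ ≤ 1 := rpow_le_one (norm_nonneg _) hu hτ0.le
  rw [hg, one_rpow] at hle
  have hfin : ‖g + ζ • u‖ ^ τ ≤ exp ((ζ * ∑' i, L i).re + 2 * C * ‖ζ‖ ^ 2) := by
    have h1 := add_one_le_exp ((ζ * ∑' i, L i).re + 2 * C * ‖ζ‖ ^ 2)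
    have h2 : C * ‖ζ‖ ^ 2 * (1 + ‖u‖ ^ τ) ≤ C * ‖ζ‖ ^ 2 * (1 + 1) := by gcongr
    linarith
  rw [← rpow_le_rpow_iff (norm_nonneg _) (exp_pos _).le hτ0, ← exp_mul]
  convert hfin using 2
  rw [← mul_div_assoc, Complex.div_ofReal_re]
  field_simp

end Smooth

/-! ### Inclusions and duality pairings of sequence spaces. -/

section Pairing

theorem continuous_lpEval {p : ℝ≥0∞} [Fact (1 ≤ p)] (i : ℤ) :
    Continuous fun x : lp (fun _ : ℤ => ℂ) p => x i :=
  (lp.lipschitzWith_one_eval p i).continuous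

/-- Closed graph theorem: limits in both spaces are detected coordinatewise. -/
theorem continuous_linearMapOfLE {p r : ℝ≥0∞} [Fact (1 ≤ p)] [Fact (1 ≤ r)] (h : p ≤ r) :
    Continuous (lp.linearMapOfLE ℂ (fun _ : ℤ => ℂ) h) := by
  refine LinearMap.continuous_of_seq_closed_graph (g := lp.linearMapOfLE ℂ (fun _ : ℤ => ℂ) h)
      fun x y z hx hy => ?_
  ext i
  have h1 := ((continuous_lpEval i).tendsto y).comp hx
  have h2 := ((continuous_lpEval i).tendsto z).comp hy
  rw [lp.coe_linearMapOfLE_apply]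
  refine tendsto_nhds_unique h2 (h1.congr fun n => ?_)
  simp only [Function.comp_apply, lp.coe_linearMapOfLE_apply]
/-- The inclusion of `ℓ_p` into `ℓ_r` for `p ≤ r`. -/
noncomputable def lpInclusion {p r : ℝ≥0∞} [Fact (1 ≤ p)] [Fact (1 ≤ r)] (h : p ≤ r) :
    lp (fun _ : ℤ => ℂ) p →L[ℂ] lp (fun _ : ℤ => ℂ) r where
  toLinearMap := lp.linearMapOfLE ℂ (fun _ : ℤ => ℂ) h
  cont := continuous_linearMapOfLE h

@[simp]
theorem lpInclusion_apply {p r : ℝ≥0∞} [Fact (1 ≤ p)] [Fact (1 ≤ r)] (h : p ≤ r)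
    (x : lp (fun _ : ℤ => ℂ) p) (i : ℤ) : lpInclusion h x i = x i := rfl

theorem norm_mul_complex_le (_ : ℤ) : ‖ContinuousLinearMap.mul ℂ ℂ‖ ≤ ((1 : NNReal) : ℝ) := by
  simp

/-- The bilinear pairing `(g, x) ↦ ∑ i, g i * x i` of `ℓ_t` and `ℓ_p`, where `p` is at most the
exponent conjugate to `t`. -/
noncomputable def lpPairing {p t r : ℝ≥0∞} [Fact (1 ≤ p)] [Fact (1 ≤ t)] [Fact (1 ≤ r)]
    [t.HolderConjugate r] (h : p ≤ r) :
    lp (fun _ : ℤ => ℂ) t →L[ℂ] lp (fun _ : ℤ => ℂ) p →L[ℂ] ℂ :=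
  ((lp.dualPairing t r (fun _ : ℤ => ContinuousLinearMap.mul ℂ ℂ)
    norm_mul_complex_le).flip.comp (lpInclusion h)).flip

theorem lpPairing_apply {p t r : ℝ≥0∞} [Fact (1 ≤ p)] [Fact (1 ≤ t)] [Fact (1 ≤ r)]
    [t.HolderConjugate r] (h : p ≤ r) (g : lp (fun _ : ℤ => ℂ) t) (x : lp (fun _ : ℤ => ℂ) p) :
    lpPairing h g x = ∑' i, g i * x i := by
  simp only [lpPairing, ContinuousLinearMap.flip_apply, ContinuousLinearMap.comp_apply]
  rw [lp.dualPairing_apply]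
  simp only [lpInclusion_apply, ContinuousLinearMap.mul_apply']

theorem lpPairing_single {p t r : ℝ≥0∞} [Fact (1 ≤ p)] [Fact (1 ≤ t)] [Fact (1 ≤ r)]
    [t.HolderConjugate r] (h : p ≤ r) (i : ℤ) (c : ℂ) (x : lp (fun _ : ℤ => ℂ) p) :
    lpPairing h (lp.single t i c) x = c * x i := by
  rw [lpPairing_apply, tsum_eq_single i]
  · simp
  · intro j hj
    simp [Pi.single_eq_of_ne hj]

end Pairing

end LinearDynamics

namespace LinearDynamics

/-! ### Tests for weak density. -/

section WeakDensity

variable {E : Type*} [NormedAddCommGroup E] [NormedSpace ℂ E]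

/-- Two functionals suffice later: a coordinate, and the functional from the plank theorem. -/
theorem WeaklyDense.exists_mem {A : Set E} (hA : WeaklyDense A) (φ ψ : E →L[ℂ] ℂ) (u : E)
    {δ : ℝ} (hδ : 0 < δ) : ∃ a ∈ A, ‖φ (a - u)‖ < δ ∧ ‖ψ (a - u)‖ < δ := by
  have hc : ∀ χ : E →L[ℂ] ℂ, Continuous fun z : WeakSpace ℂ E =>
      ‖χ ((toWeakSpace ℂ E).symm z) - χ u‖ := fun χ =>
    ((WeakBilin.eval_continuous (topDualPairing ℂ E).flip χ).sub continuous_const).norm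
  have hopen : IsOpen {z : WeakSpace ℂ E | ‖φ ((toWeakSpace ℂ E).symm z) - φ u‖ < δ ∧
      ‖ψ ((toWeakSpace ℂ E).symm z) - ψ u‖ < δ} :=
    (isOpen_lt (hc φ) continuous_const).inter (isOpen_lt (hc ψ) continuous_const)
  obtain ⟨z, hz, a, ha, rfl⟩ := hA.inter_open_nonempty _ hopen
    ⟨toWeakSpace ℂ E u, by simpa using hδ⟩
  refine ⟨a, ha, ?_⟩
  rw [map_sub, map_sub]
  exact hz

/-- Targets in a norm dense set are enough, because weakly open sets are norm open. -/
theorem weaklyDense_of_forall_finset {A D : Set E} (hD : Dense D)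
    (h : ∀ u ∈ D, ∀ (Φ : Finset (E →L[ℂ] ℂ)) (δ : ℝ), 0 < δ →
      ∃ a ∈ A, ∀ φ ∈ Φ, ‖φ (a - u)‖ < δ) : WeaklyDense A := by
  refine dense_iff_inter_open.2 fun U hU hne => ?_
  have hU' : IsOpen (toWeakSpaceCLM ℂ E ⁻¹' U) := hU.preimage (toWeakSpaceCLM ℂ E).continuous
  have hne' : (toWeakSpaceCLM ℂ E ⁻¹' U).Nonempty := by
    obtain ⟨z, hz⟩ := hne
    exact ⟨(toWeakSpace ℂ E).symm z, by simpa using hz⟩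
  obtain ⟨u, huU, huD⟩ := hD.inter_open_nonempty _ hU' hne'
  have hnhds : {z : WeakSpace ℂ E | z + toWeakSpace ℂ E u ∈ U} ∈ nhds (0 : WeakSpace ℂ E) := by
    have hc : Continuous fun z : WeakSpace ℂ E => z + toWeakSpace ℂ E u :=
      continuous_id.add continuous_const
    refine hc.continuousAt.preimage_mem_nhds (hU.mem_nhds ?_)
    simpa using huU
  obtain ⟨V, hV, hVU⟩ :=
    (LinearMap.hasBasis_weakBilin (topDualPairing ℂ E).flip).mem_iff.1 hnhds
  obtain ⟨Φ, r, hr, rfl⟩ := (SeminormFamily.basisSets_iff _).1 hV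
  obtain ⟨a, ha, haΦ⟩ := h u huD Φ r hr
  refine ⟨toWeakSpace ℂ E a, ?_, Set.mem_image_of_mem _ ha⟩
  have hmem : toWeakSpace ℂ E (a - u) ∈ {z : WeakSpace ℂ E | z + toWeakSpace ℂ E u ∈ U} := by
    apply hVU
    have hsup : Φ.sup (LinearMap.toSeminormFamily (topDualPairing ℂ E).flip) (a - u) < r :=
      Seminorm.finset_sup_apply_lt hr fun φ hφ => haΦ φ hφ
    exact (Seminorm.mem_ball_zero _).2 hsup
  have hadd : toWeakSpace ℂ E (a - u) + toWeakSpace ℂ E u = toWeakSpace ℂ E a := by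
    rw [← map_add, sub_add_cancel]
  rw [← hadd]
  exact hmem

/-- A sequence of vectors has `0` as a weak cluster point as soon as suitable finite combinations
are small compared with the sum of their coefficients. -/
theorem exists_forall_norm_apply_lt {ι : Type*} (R : ι → E) (Φ : Finset (E →L[ℂ] ℂ)) {δ : ℝ}
    (F : Finset ι) (a : ι → ℝ) (ha : ∀ k ∈ F, 0 ≤ a k) {B : ℝ}
    (hB : ∀ θ : ι → ℂ, (∀ k, ‖θ k‖ ≤ 1) → ‖∑ k ∈ F, ((a k : ℂ) * θ k) • R k‖ ≤ B)
    (hlt : (∑ φ ∈ Φ, ‖φ‖) * B < δ * ∑ k ∈ F, a k) :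
    ∃ k ∈ F, ∀ φ ∈ Φ, ‖φ (R k)‖ < δ := by
  by_contra! hcon
  have h1 : ∀ φ ∈ Φ, ∑ k ∈ F, a k * ‖φ (R k)‖ ≤ ‖φ‖ * B := by
    intro φ _
    -- Phases aligned with `φ (R k)` turn the norm bound into a bound on `∑ a k * ‖φ (R k)‖`; a
    -- failure at every `k` would force these sums, added over `Φ`, to be at least `δ * ∑ a k`.
    set θ : ι → ℂ := fun k => (starRingEnd ℂ) (φ (R k)) / ‖φ (R k)‖ with hθ
    have hθ1 : ∀ k, ‖θ k‖ ≤ 1 := by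
      intro k
      simp only [hθ, norm_div, RCLike.norm_conj, Complex.norm_real, norm_norm]
      exact div_self_le_one _
    have hθ2 : ∀ k, θ k * φ (R k) = (‖φ (R k)‖ : ℂ) := by
      intro k
      rcases eq_or_ne (φ (R k)) 0 with h0 | h0
      · simp [h0]
      · have : (‖φ (R k)‖ : ℂ) ≠ 0 := by simpa using h0
        rw [hθ]
        simp only
        rw [div_mul_eq_mul_div, div_eq_iff this, mul_comm, Complex.mul_conj,
          Complex.normSq_eq_norm_sq]
        push_cast
        ring
    have h2 := (φ.le_opNorm _).trans (mul_le_mul_of_nonneg_left (hB θ hθ1) (norm_nonneg φ))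
    rw [map_sum] at h2
    have h3 : ∑ k ∈ F, φ (((a k : ℂ) * θ k) • R k) = ((∑ k ∈ F, a k * ‖φ (R k)‖ : ℝ) : ℂ) := by
      push_cast
      refine Finset.sum_congr rfl fun k _ => ?_
      rw [map_smul, smul_eq_mul, mul_assoc, hθ2]
    rw [h3, Complex.norm_real] at h2
    exact (le_abs_self _).trans h2
  have h2 : δ * ∑ k ∈ F, a k ≤ ∑ φ ∈ Φ, ∑ k ∈ F, a k * ‖φ (R k)‖ := by
    rw [Finset.sum_comm, Finset.mul_sum]
    refine Finset.sum_le_sum fun k hk => ?_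
    obtain ⟨φ, hφ, hle⟩ := hcon k hk
    rw [← Finset.mul_sum, mul_comm]
    refine mul_le_mul_of_nonneg_left (hle.trans ?_) (ha k hk)
    exact Finset.single_le_sum (f := fun φ : E →L[ℂ] ℂ => ‖φ (R k)‖)
      (fun _ _ => norm_nonneg _) hφ
  have h3 := h2.trans (Finset.sum_le_sum h1)
  rw [← Finset.sum_mul] at h3
  exact absurd hlt (not_lt.2 h3)

end WeakDensity

/-! ### Birkhoff transitivity in the norm topology. -/

section Universality

open TopologicalSpace

/-- Birkhoff's transitivity argument for a family of continuous maps. -/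
theorem exists_dense_range_of_transitive {X : Type*} [MetricSpace X] [CompleteSpace X]
    [SeparableSpace X] [Nonempty X] {ι : Type*} (f : ι → X → X) (hf : ∀ a, Continuous (f a))
    {S : Set X} (hS : Dense S)
    (h : ∀ u ∈ S, ∀ v ∈ S, ∀ η > 0, ∃ z a, dist z u < η ∧ dist (f a z) v < η) :
    ∃ x, Dense (Set.range fun a => f a x) := by
  obtain ⟨D, hDS, hDc, hD⟩ := hS.exists_countable_dense_subset
  have := hDc.to_subtype
  let O : D × ℕ → Set X := fun vm => ⋃ a, f a ⁻¹' Metric.ball vm.1 (1 / ((vm.2 : ℝ) + 1))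
  have hO : ∀ vm, IsOpen (O vm) := fun vm =>
    isOpen_iUnion fun a => Metric.isOpen_ball.preimage (hf a)
  have hOd : ∀ vm, Dense (O vm) := by
    intro vm
    refine Metric.dense_iff.2 fun x r hr => ?_
    obtain ⟨u, huS, hu⟩ := hS.exists_dist_lt x (half_pos hr)
    obtain ⟨z, a, hz, ha⟩ := h u huS vm.1 (hDS vm.1.2) (min (r / 2) (1 / ((vm.2 : ℝ) + 1)))
      (lt_min (half_pos hr) (by positivity))
    refine ⟨z, ?_, Set.mem_iUnion.2 ⟨a, ha.trans_le (min_le_right _ _)⟩⟩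
    have h1 := hz.trans_le (min_le_left _ _)
    rw [Metric.mem_ball]
    calc dist z x ≤ dist z u + dist x u := dist_triangle_right _ _ _
      _ < r := by linarith
  obtain ⟨x, hx⟩ := (dense_iInter_of_isOpen hO hOd).nonempty
  refine ⟨x, Metric.dense_iff.2 fun y r hr => ?_⟩
  obtain ⟨v, hvD, hv⟩ := hD.exists_dist_lt y (half_pos hr)
  obtain ⟨m, hm⟩ := exists_nat_one_div_lt (half_pos hr)
  obtain ⟨a, ha⟩ := Set.mem_iUnion.1 (Set.mem_iInter.1 hx (⟨v, hvD⟩, m))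
  refine ⟨f a x, ?_, Set.mem_range_self a⟩
  rw [Set.mem_preimage, Metric.mem_ball] at ha
  rw [Metric.mem_ball]
  calc dist (f a x) y ≤ dist (f a x) v + dist y v := dist_triangle_right _ _ _
    _ < r := by
      simp only at ha
      linarith

end Universality

/-! ### Weighted shifts in terms of a potential. -/

section Shift

variable {p : ℝ≥0∞} [Fact (1 ≤ p)]

/-- `T` acts as a pure backward shift on the rescaled basis `β n • e_n`. -/
def HasPotential (T : lp (fun _ : ℤ => ℂ) p →L[ℂ] lp (fun _ : ℤ => ℂ) p) (β : ℤ → ℂ) : Prop :=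
  (∀ n, β n ≠ 0) ∧ ∀ n, T (lp.single p n (β n)) = lp.single p (n - 1) (β (n - 1))

/-- The recursion is solved from `β 0 = 1`, dividing by weights to the right and multiplying by them
to the left. -/
theorem exists_potential {w : ℤ → ℂ} (hw : ∀ n, w n ≠ 0) :
    ∃ β : ℤ → ℂ, (∀ n, β n ≠ 0) ∧ ∀ n, β (n - 1) = w n * β n := by
  let β : ℤ → ℂ := fun n => match n with
    | Int.ofNat k => ∏ i ∈ Finset.range k, (w (i + 1))⁻¹
    | Int.negSucc k => ∏ i ∈ Finset.range (k + 1), w (-i)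
  refine ⟨β, ?_, ?_⟩
  · rintro (k | k)
    · exact Finset.prod_ne_zero_iff.2 fun i _ => inv_ne_zero (hw _)
    · exact Finset.prod_ne_zero_iff.2 fun i _ => hw _
  · rintro (k | k)
    · rcases k with _ | k
      · change (∏ i ∈ Finset.range 1, w (-i)) = w 0 * ∏ i ∈ Finset.range 0, (w (i + 1))⁻¹
        simp
      · have e : Int.ofNat (k + 1) - 1 = Int.ofNat k := by simp
        rw [e]
        change (∏ i ∈ Finset.range k, (w (i + 1))⁻¹) =
          w ((k + 1 : ℕ) : ℤ) * ∏ i ∈ Finset.range (k + 1), (w (i + 1))⁻¹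
        rw [Finset.prod_range_succ, mul_left_comm]
        push_cast
        rw [mul_inv_cancel₀ (hw _), mul_one]
    · have e : Int.negSucc k - 1 = Int.negSucc (k + 1) := by omega
      rw [e]
      change (∏ i ∈ Finset.range (k + 1 + 1), w (-i)) =
        w (Int.negSucc k) * ∏ i ∈ Finset.range (k + 1), w (-i)
      rw [Finset.prod_range_succ, mul_comm]
      congr 2

theorem smul_lp_single {p : ℝ≥0∞} (c a : ℂ) (n : ℤ) :
    c • (lp.single p n a : lp (fun _ : ℤ => ℂ) p) = lp.single p n (c * a) := by
  rw [← smul_eq_mul, lp.single_smul]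

theorem IsBilateralWeightedShift.exists_hasPotential
    {T : lp (fun _ : ℤ => ℂ) p →L[ℂ] lp (fun _ : ℤ => ℂ) p} (hT : IsBilateralWeightedShift T) :
    ∃ β, HasPotential T β ∧ ∃ C : ℝ, 1 ≤ C ∧ ∀ n, ‖β (n - 1)‖ ≤ C * ‖β n‖ := by
  obtain ⟨w, hw, ⟨C, hC⟩, hTw⟩ := hT
  obtain ⟨β, hβ, hrec⟩ := exists_potential hw
  refine ⟨β, ⟨hβ, fun n => ?_⟩, max 1 C, le_max_left _ _, fun n => ?_⟩
  · have h1 : (lp.single p n (β n) : lp (fun _ : ℤ => ℂ) p) = β n • lp.single p n (1 : ℂ) := by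
      rw [smul_lp_single, mul_one]
    rw [h1, map_smul, hTw, smul_lp_single, smul_lp_single, hrec]
    congr 1
    ring
  · rw [hrec, norm_mul]
    gcongr
    exact (hC n).trans (le_max_right _ _)

theorem norm_potential_sub_le {β : ℤ → ℂ} {C : ℝ} (hC : 1 ≤ C)
    (h : ∀ n, ‖β (n - 1)‖ ≤ C * ‖β n‖) (n : ℤ) (d : ℕ) : ‖β (n - d)‖ ≤ C ^ d * ‖β n‖ := by
  induction d with
  | zero => simp
  | succ d ih =>
    have h1 := h (n - d)
    have e : n - ((d + 1 : ℕ) : ℤ) = n - d - 1 := by push_cast; ring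
    rw [e, pow_succ']
    calc _ ≤ C * ‖β (n - d)‖ := h1
      _ ≤ C * (C ^ d * ‖β n‖) := by gcongr
      _ = _ := by ring

variable {T : lp (fun _ : ℤ => ℂ) p →L[ℂ] lp (fun _ : ℤ => ℂ) p} {β : ℤ → ℂ}

theorem HasPotential.pow_single (hT : HasPotential T β) (n : ℕ) (m : ℤ) :
    (T ^ n) (lp.single p m (β m)) = lp.single p (m - n) (β (m - n)) := by
  induction n with
  | zero => simp
  | succ n ih =>
    rw [pow_succ', mul_apply_eq_comp, ih, hT.2]
    have e : m - n - 1 = m - ((n + 1 : ℕ) : ℤ) := by push_cast; ring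
    rw [e]

/-- Both sides are continuous functionals of `x`, so agreement on the canonical basis is enough for
finite `p`. -/
theorem HasPotential.pow_apply (hT : HasPotential T β) (hp : p ≠ ∞) (n : ℕ)
    (x : lp (fun _ : ℤ => ℂ) p) (k : ℤ) :
    (T ^ n) x k = β k * (x (k + n) / β (k + n)) := by
  have h : (lp.evalCLM ℂ (fun _ : ℤ => ℂ) p k).comp (T ^ n) =
      (β k / β (k + n)) • lp.evalCLM ℂ (fun _ : ℤ => ℂ) p (k + n) := by
    refine lp.ext_continuousLinearMap hp fun i => ?_
    ext
    have h1 : (lp.single p i (1 : ℂ) : lp (fun _ : ℤ => ℂ) p) = (β i)⁻¹ • lp.single p i (β i) := by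
      rw [smul_lp_single, inv_mul_cancel₀ (hT.1 i)]
    change (T ^ n) (lp.single p i (1 : ℂ)) k =
      (β k / β (k + n)) * (lp.single p i (1 : ℂ) : lp (fun _ : ℤ => ℂ) p) (k + n)
    rw [h1, map_smul, hT.pow_single]
    simp only [lp.coeFn_smul, Pi.smul_apply, smul_eq_mul, lp.single_apply]
    rcases eq_or_ne i (k + n) with rfl | hne
    · simp [hT.1]
      field_simp [hT.1 (k + n)]
    · rw [Pi.single_eq_of_ne (by omega), Pi.single_eq_of_ne hne.symm]
      simp
  have := DFunLike.congr_fun h x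
  change (T ^ n) x k = (β k / β (k + n)) * x (k + n) at this
  rw [this]
  ring

/-- The finite combination `∑ v i • (β (i - m) • e_{i - m})`. -/
noncomputable def shiftComb (p : ℝ≥0∞) [Fact (1 ≤ p)] (β : ℤ → ℂ) (m : ℤ) :
    (ℤ →₀ ℂ) →ₗ[ℂ] lp (fun _ : ℤ => ℂ) p :=
  Finsupp.linearCombination ℂ fun i => lp.single p (i - m) (β (i - m))

theorem shiftComb_apply (m : ℤ) (v : ℤ →₀ ℂ) :
    shiftComb p β m v = ∑ i ∈ v.support, v i • lp.single p (i - m) (β (i - m)) := rfl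

theorem HasPotential.pow_shiftComb (hT : HasPotential T β) (n : ℕ) (m : ℤ) (v : ℤ →₀ ℂ) :
    (T ^ n) (shiftComb p β m v) = shiftComb p β (m + n) v := by
  rw [shiftComb_apply, shiftComb_apply, map_sum]
  refine Finset.sum_congr rfl fun i _ => ?_
  rw [map_smul, hT.pow_single, sub_sub]

theorem norm_shiftComb_le (m : ℤ) (v : ℤ →₀ ℂ) :
    ‖shiftComb p β m v‖ ≤ ∑ i ∈ v.support, ‖v i‖ * ‖β (i - m)‖ := by
  rw [shiftComb_apply]
  refine (norm_sum_le _ _).trans (Finset.sum_le_sum fun i _ => ?_)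
  rw [norm_smul, lp.norm_single (zero_lt_one.trans_le Fact.out)]

/-- Bounded weights control `β` only when moving left, so the whole support is compared with an
index `q` to its right. -/
theorem exists_norm_shiftComb_le {C : ℝ} (hC : 1 ≤ C) (h : ∀ n, ‖β (n - 1)‖ ≤ C * ‖β n‖)
    (v : ℤ →₀ ℂ) (q : ℤ) (hq : ∀ i ∈ v.support, i ≤ q) :
    ∃ K : ℝ, 0 < K ∧ ∀ m, ‖shiftComb p β m v‖ ≤ K * ‖β (q - m)‖ := by
  refine ⟨1 + ∑ i ∈ v.support, ‖v i‖ * C ^ (q - i).toNat, by positivity, fun m => ?_⟩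
  refine (norm_shiftComb_le m v).trans ?_
  rw [add_mul, one_mul, Finset.sum_mul]
  refine le_add_of_nonneg_of_le (norm_nonneg _) (Finset.sum_le_sum fun i hi => ?_)
  rw [mul_assoc]
  gcongr
  have h1 := norm_potential_sub_le hC h (q - m) (q - i).toNat
  have e : q - m - ((q - i).toNat : ℤ) = i - m := by
    rw [Int.toNat_of_nonneg (sub_nonneg.2 (hq i hi))]
    ring
  rwa [e] at h1

theorem lp_single_mem_range_shiftComb (hβ : ∀ n, β n ≠ 0) (i : ℤ) (c : ℂ) :
    lp.single p i c ∈ LinearMap.range (shiftComb p β 0) := by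
  refine ⟨Finsupp.single i (c / β i), ?_⟩
  rw [shiftComb, Finsupp.linearCombination_single, smul_lp_single, sub_zero,
    div_mul_cancel₀ _ (hβ i)]

theorem denseRange_shiftComb (hp : p ≠ ∞) (hβ : ∀ n, β n ≠ 0) :
    Dense (Set.range (shiftComb p β 0)) := by
  intro x
  refine mem_closure_of_tendsto (lp.hasSum_single hp x) (Filter.Eventually.of_forall fun s => ?_)
  exact Submodule.sum_mem (LinearMap.range (shiftComb p β 0))
    fun i _ => lp_single_mem_range_shiftComb hβ i (x i)

theorem separableSpace_lp (hp : p ≠ ∞) :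
    TopologicalSpace.SeparableSpace (lp (fun _ : ℤ => ℂ) p) := by
  rw [← TopologicalSpace.isSeparable_univ_iff]
  have h1 : TopologicalSpace.IsSeparable
      (Set.range fun i : ℤ => (lp.single p i (1 : ℂ) : lp (fun _ : ℤ => ℂ) p)) :=
    (Set.countable_range _).isSeparable
  have h2 := (h1.span (R := ℂ)).closure
  refine h2.mono fun x _ => ?_
  refine mem_closure_of_tendsto (lp.hasSum_single hp x) (Filter.Eventually.of_forall fun s => ?_)
  refine Submodule.sum_mem _ fun i _ => ?_
  have : (lp.single p i (x i) : lp (fun _ : ℤ => ℂ) p) = x i • lp.single p i (1 : ℂ) := by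
    rw [smul_lp_single, mul_one]
  rw [this]
  exact Submodule.smul_mem _ _ (Submodule.subset_span ⟨i, rfl⟩)

end Shift

end LinearDynamics

namespace LinearDynamics

variable {p : ℝ≥0∞} [Fact (1 ≤ p)]
  {T : lp (fun _ : ℤ => ℂ) p →L[ℂ] lp (fun _ : ℤ => ℂ) p} {β : ℤ → ℂ}

/-! ### Salas' sufficient conditions. -/

section Criteria

theorem exists_norm_shiftComb_pair_le {C : ℝ} (hC : 1 ≤ C)
    (h : ∀ n, ‖β (n - 1)‖ ≤ C * ‖β n‖) (a b : ℤ →₀ ℂ) :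
    ∃ (q : ℤ) (K : ℝ), 0 < K ∧ (∀ m, ‖shiftComb p β m a‖ ≤ K * ‖β (q - m)‖) ∧
      ∀ m, ‖shiftComb p β m b‖ ≤ K * ‖β (q - m)‖ := by
  obtain ⟨q, hq⟩ := (a.support ∪ b.support).exists_le
  obtain ⟨K₁, hK₁, h₁⟩ := exists_norm_shiftComb_le (p := p) hC h a q
    fun i hi => hq i (Finset.mem_union_left _ hi)
  obtain ⟨K₂, hK₂, h₂⟩ := exists_norm_shiftComb_le (p := p) hC h b q
    fun i hi => hq i (Finset.mem_union_right _ hi)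
  refine ⟨q, max K₁ K₂, lt_max_of_lt_left hK₁, fun m => (h₁ m).trans ?_, fun m => (h₂ m).trans ?_⟩
  · gcongr; exact le_max_left _ _
  · gcongr; exact le_max_right _ _

/-- Salas' criterion for hypercyclicity (sufficiency). -/
theorem HasPotential.hypercyclic (hT : HasPotential T β) (hp : p ≠ ∞) {C : ℝ} (hC : 1 ≤ C)
    (hβ : ∀ n, ‖β (n - 1)‖ ≤ C * ‖β n‖)
    (h : ∀ (q : ℤ) (ε : ℝ), 0 < ε → ∃ n : ℕ, ‖β (q + n)‖ < ε ∧ ‖β (q - n)‖ < ε) :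
    Hypercyclic T := by
  have := separableSpace_lp (p := p) hp
  obtain ⟨x, hx⟩ := exists_dense_range_of_transitive (fun (n : ℕ) x => (T ^ n) x)
    (fun n => (T ^ n).continuous) (denseRange_shiftComb (p := p) hp hT.1) (by
      rintro _ ⟨a, rfl⟩ _ ⟨b, rfl⟩ η hη
      obtain ⟨q, K, hK, ha, hb⟩ := exists_norm_shiftComb_pair_le (p := p) hC hβ a b
      obtain ⟨n, hn₁, hn₂⟩ := h q (η / K) (by positivity)
      -- `T ^ n` sends the second summand exactly to the target; that summand is small through `β (q
      -- + n)`, and the image of the first through `β (q - n)`.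
      refine ⟨shiftComb p β 0 a + shiftComb p β (-n) b, n, ?_, ?_⟩
      · rw [dist_eq_norm, add_sub_cancel_left]
        refine (hb _).trans_lt ?_
        rw [sub_neg_eq_add]
        rwa [lt_div_iff₀' hK] at hn₁
      · rw [map_add, hT.pow_shiftComb, hT.pow_shiftComb, neg_add_cancel, dist_eq_norm,
          add_sub_cancel_right]
        refine (ha _).trans_lt ?_
        rw [zero_add]
        rwa [lt_div_iff₀' hK] at hn₂)
  refine ⟨x, ?_⟩
  convert hx using 1
  ext y
  exact exists_congr fun n => eq_comm

/-- Salas' criterion for supercyclicity (sufficiency). -/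
theorem HasPotential.supercyclic (hT : HasPotential T β) (hp : p ≠ ∞) {C : ℝ} (hC : 1 ≤ C)
    (hβ : ∀ n, ‖β (n - 1)‖ ≤ C * ‖β n‖)
    (h : ∀ (q : ℤ) (ε : ℝ), 0 < ε → ∃ n : ℕ, ‖β (q + n)‖ * ‖β (q - n)‖ < ε) :
    Supercyclic T := by
  have := separableSpace_lp (p := p) hp
  obtain ⟨x, hx⟩ := exists_dense_range_of_transitive (fun (a : ℕ × ℂ) x => a.2 • (T ^ a.1) x)
    (fun a => (T ^ a.1).continuous.const_smul a.2) (denseRange_shiftComb (p := p) hp hT.1) (by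
      rintro _ ⟨a, rfl⟩ _ ⟨b, rfl⟩ η hη
      obtain ⟨q, K, hK, ha, hb⟩ := exists_norm_shiftComb_pair_le (p := p) hC hβ a b
      obtain ⟨n, hn⟩ := h q ((η / K) ^ 2) (by positivity)
      have hβ₁ : 0 < ‖β (q + n)‖ := norm_pos_iff.2 (hT.1 _)
      have hβ₂ : 0 < ‖β (q - n)‖ := norm_pos_iff.2 (hT.1 _)
      have hs : √(‖β (q + n)‖) * √(‖β (q - n)‖) < η / K := by
        rw [← Real.sqrt_mul hβ₁.le]
        exact (Real.sqrt_lt' (by positivity)).2 hn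
      rw [lt_div_iff₀' hK] at hs
      set s₁ := √(‖β (q + n)‖) with hs₁
      set s₂ := √(‖β (q - n)‖) with hs₂
      have hs₁0 : 0 < s₁ := Real.sqrt_pos.2 hβ₁
      have hs₂0 : 0 < s₂ := Real.sqrt_pos.2 hβ₂
      have e₁ : ‖β (q + n)‖ = s₁ * s₁ := (Real.mul_self_sqrt hβ₁.le).symm
      have e₂ : ‖β (q - n)‖ = s₂ * s₂ := (Real.mul_self_sqrt hβ₂.le).symm
      have hc : ‖((s₁ / s₂ : ℝ) : ℂ)‖ = s₁ / s₂ := by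
        rw [Complex.norm_real, Real.norm_of_nonneg (by positivity)]
      have hc0 : ((s₁ / s₂ : ℝ) : ℂ) ≠ 0 := by
        rw [← norm_ne_zero_iff, hc]; positivity
      -- The scalar `s₁ / s₂` balances the two errors: both become at most `K * s₁ * s₂`.
      refine ⟨shiftComb p β 0 a + ((s₁ / s₂ : ℝ) : ℂ)⁻¹ • shiftComb p β (-n) b,
        (n, ((s₁ / s₂ : ℝ) : ℂ)), ?_, ?_⟩
      · rw [dist_eq_norm, add_sub_cancel_left, norm_smul, norm_inv, hc]
        refine (mul_le_mul_of_nonneg_left (hb _) (by positivity)).trans_lt ?_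
        rw [sub_neg_eq_add, e₁]
        refine lt_of_eq_of_lt ?_ hs
        field_simp
      · simp only
        rw [map_add, map_smul, hT.pow_shiftComb, hT.pow_shiftComb, neg_add_cancel, smul_add,
          smul_inv_smul₀ hc0, dist_eq_norm, add_sub_cancel_right, norm_smul, hc]
        refine (mul_le_mul_of_nonneg_left (ha _) (by positivity)).trans_lt ?_
        rw [zero_add, e₂]
        refine lt_of_eq_of_lt ?_ hs
        field_simp)
  refine ⟨x, ?_⟩
  convert hx using 1
  ext y
  constructor
  · rintro ⟨n, c, rfl⟩
    exact ⟨(n, c), rfl⟩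
  · rintro ⟨⟨n, c⟩, rfl⟩
    exact ⟨n, c, rfl⟩

end Criteria

/-! ### Weakly supercyclic shifts for `p ≤ 2`. -/

section Necessity

theorem norm_apply_le_norm_lpPairing {t r : ℝ≥0∞} [Fact (1 ≤ t)] [Fact (1 ≤ r)]
    [t.HolderConjugate r] (h : p ≤ r) (y : lp (fun _ : ℤ => ℂ) p) (i : ℤ) :
    ‖y i‖ ≤ ‖(lpPairing (t := t) h).flip y‖ := by
  have h1 := ((lpPairing (t := t) h).flip y).le_opNorm (lp.single t i (1 : ℂ))
  rwa [lp.norm_single (zero_lt_one.trans_le Fact.out), norm_one, mul_one,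
    ContinuousLinearMap.flip_apply, lpPairing_single, one_mul] at h1

/-- Supplies target coordinates that the orbit never attains, so that the error functionals are
nonzero as the plank theorem requires. -/
theorem exists_notMem_range_dist_lt (f : ℕ → ℂ) (c : ℂ) {δ : ℝ} (hδ : 0 < δ) :
    ∃ z : ℂ, (∀ n, f n ≠ z) ∧ dist z c < δ := by
  obtain ⟨z, hz, hzc⟩ := ((Set.countable_range f).dense_compl ℂ).exists_dist_lt c hδ
  exact ⟨z, fun n hn => hz ⟨n, hn⟩, by rwa [dist_comm]⟩

theorem HasPotential.exists_mul_lt_of_weaklySupercyclic (hT : HasPotential T β) (hp2 : p ≤ 2)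
    {C : ℝ} (hC : 1 ≤ C) (hβ : ∀ n, ‖β (n - 1)‖ ≤ C * ‖β n‖) (hw : WeaklySupercyclic T)
    (q : ℤ) (ε : ℝ) (hε : 0 < ε) : ∃ n : ℕ, ‖β (q + n)‖ * ‖β (q - n)‖ < ε := by
  by_contra! hcon
  have hp : p ≠ ∞ := ne_top_of_le_ne_top (by simp) hp2
  obtain ⟨x, hx⟩ := hw
  have hβ0 : ∀ n, 0 < ‖β n‖ := fun n => norm_pos_iff.2 (hT.1 n)
  have hcoord : ∀ n : ℕ, (T ^ n) x q ≠ 0 ↔ x (q + n) ≠ 0 := by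
    intro n
    rw [hT.pow_apply hp]
    simp [hT.1]
  obtain ⟨d, hd⟩ : ∃ d : ℕ, x (q + d) ≠ 0 := by
    obtain ⟨a, ⟨n, c, rfl⟩, ha, -⟩ := hx.exists_mem (lp.evalCLM ℂ (fun _ : ℤ => ℂ) p q)
      (lp.evalCLM ℂ (fun _ : ℤ => ℂ) p q) (lp.single p q (1 : ℂ)) one_pos
    refine ⟨n, (hcoord n).1 fun h0 => ?_⟩
    change ‖c * (T ^ n) x q - (lp.single p q (1 : ℂ) : lp (fun _ : ℤ => ℂ) p) q‖ < 1 at ha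
    rw [h0, lp.single_apply_self] at ha
    norm_num at ha
  obtain ⟨c, hc, -⟩ := exists_notMem_range_dist_lt
    (fun n : ℕ => ((T ^ n) x q)⁻¹ * (T ^ n) x (q + 1)) 0 one_pos
  -- Coordinate `q` fixes the free scalar; coordinate `q + 1` keeps every normalised orbit vector
  -- different from `u`.
  let u : lp (fun _ : ℤ => ℂ) p := lp.single p q (1 : ℂ) + lp.single p (q + 1) c
  have huq : u q = 1 := by
    change (lp.single p q (1 : ℂ) : lp (fun _ : ℤ => ℂ) p) q +
      (lp.single p (q + 1) c : lp (fun _ : ℤ => ℂ) p) q = 1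
    rw [lp.single_apply_self, lp.single_apply_ne _ _ _ (by omega), add_zero]
  have huq1 : u (q + 1) = c := by
    change (lp.single p q (1 : ℂ) : lp (fun _ : ℤ => ℂ) p) (q + 1) +
      (lp.single p (q + 1) c : lp (fun _ : ℤ => ℂ) p) (q + 1) = c
    rw [lp.single_apply_self, lp.single_apply_ne _ _ _ (by omega), zero_add]
  have huo : ∀ i, i < q → u i = 0 := by
    intro i hi
    change (lp.single p q (1 : ℂ) : lp (fun _ : ℤ => ℂ) p) i +
      (lp.single p (q + 1) c : lp (fun _ : ℤ => ℂ) p) i = 0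
    rw [lp.single_apply_ne _ _ _ (by omega), lp.single_apply_ne _ _ _ (by omega), zero_add]
  let y : {n : ℕ // x (q + n) ≠ 0} → lp (fun _ : ℤ => ℂ) p := fun n =>
    ((T ^ n.1) x q)⁻¹ • (T ^ n.1) x - u
  have hyi : ∀ n i, y n i = ((T ^ n.1) x q)⁻¹ * (T ^ n.1) x i - u i := fun _ _ => rfl
  let Λ := lpPairing (p := p) (t := 2) (r := 2) hp2
  have hΛ0 : ∀ n, Λ.flip (y n) ≠ 0 := by
    intro n h0
    have h1 := norm_apply_le_norm_lpPairing (t := 2) hp2 (y n) (q + 1)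
    rw [show (lpPairing (t := 2) hp2).flip (y n) = 0 from h0, norm_zero, hyi, huq1] at h1
    exact hc n.1 (sub_eq_zero.1 (norm_le_zero_iff.1 h1))
  set κ := ε * ‖x (q + d) / β (q + d)‖ / (C ^ d * ‖β q‖) with hκ
  have hκ0 : 0 < κ := by
    have h1 : 0 < ‖x (q + d) / β (q + d)‖ := norm_pos_iff.2 (div_ne_zero hd (hT.1 _))
    have := hβ0 q
    positivity
  -- Coordinate `q + d - n` of `T ^ n x` carries the fixed nonzero entry `x (q + d)`, while
  -- normalising divides by a multiple of `x (q + n) / β (q + n)`. The assumed lower bound on `β (q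
  -- + n) β (q - n)` applies after moving `d` steps; `d < n` places the coordinate to the left of
  -- the support of `u`.
  have hlow : ∀ n : {n : ℕ // x (q + n) ≠ 0}, d < n.1 →
      κ / ‖x (q + n.1)‖ ≤ ‖Λ.flip (y n)‖ := by
    intro n hn
    refine le_trans ?_ (norm_apply_le_norm_lpPairing (t := 2) hp2 (y n) (q + d - n.1))
    have hxn : 0 < ‖x (q + n.1)‖ := norm_pos_iff.2 n.2
    rw [hyi, huo _ (by omega), sub_zero, norm_mul, norm_inv, hT.pow_apply hp, hT.pow_apply hp,
      sub_add_cancel, norm_mul, norm_mul, norm_div (x (q + n.1))]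
    have h1 := hcon n.1
    have h2 := norm_potential_sub_le hC hβ (q + d - n.1) d
    rw [show q + d - (n.1 : ℤ) - d = q - n.1 by ring] at h2
    have h3 : ε ≤ ‖β (q + n.1)‖ * (C ^ d * ‖β (q + d - n.1)‖) :=
      h1.trans (mul_le_mul_of_nonneg_left h2 (norm_nonneg _))
    have b1 := hβ0 q
    have b2 := hβ0 (q + n.1)
    have hCd : 0 < C ^ d := by positivity
    rw [hκ]
    calc ε * ‖x (q + d) / β (q + d)‖ / (C ^ d * ‖β q‖) / ‖x (q + n.1)‖
        ≤ ‖β (q + n.1)‖ * (C ^ d * ‖β (q + d - n.1)‖) *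
          ‖x (q + d) / β (q + d)‖ / (C ^ d * ‖β q‖) / ‖x (q + n.1)‖ := by gcongr
      _ = _ := by
        field_simp
  have hxsum : Summable fun n : {n : ℕ // x (q + n) ≠ 0} => ‖x (q + n.1)‖ ^ 2 / κ ^ 2 := by
    have h2 : Summable fun i => ‖x i‖ ^ (2 : ℝ≥0∞).toReal :=
      ((lp.memℓp x).of_exponent_ge hp2).summable (by simp)
    have hinj : Function.Injective fun n : {n : ℕ // x (q + n) ≠ 0} => q + (n.1 : ℤ) := by
      intro m n hmn
      apply Subtype.ext
      simpa using hmn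
    have h3 := (h2.comp_injective hinj).div_const (κ ^ 2)
    simpa [Function.comp_def] using h3
  have hsum : Summable fun n => (‖Λ.flip (y n)‖ ^ 2)⁻¹ := by
    refine hxsum.of_norm_bounded_eventually ?_
    have hfin : {n : {n : ℕ // x (q + n) ≠ 0} | n.1 ≤ d}.Finite :=
      (Set.finite_Iic d).preimage Subtype.val_injective.injOn
    filter_upwards [hfin.compl_mem_cofinite] with n hn
    have hn' : d < n.1 := not_le.1 hn
    have hxn : 0 < ‖x (q + n.1)‖ := norm_pos_iff.2 n.2
    rw [Real.norm_of_nonneg (by positivity), ← div_pow, ← inv_pow]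
    have h1 := hlow n hn'
    have h4 : (‖Λ.flip (y n)‖)⁻¹ ≤ (κ / ‖x (q + n.1)‖)⁻¹ := inv_anti₀ (by positivity) h1
    rw [inv_div] at h4
    exact pow_le_pow_left₀ (by positivity) h4 2
  obtain ⟨K, hK, hsmooth⟩ := exists_quadraticallySmooth_lp 2 (by simp)
  obtain ⟨ψ, hψ⟩ := hsmooth.exists_dual_one_le hK Λ y hΛ0 hsum
  -- Replacing the scalar by the exact normalisation costs at most `δ * (1 + ‖ψ u‖) = 1 / 2`, so
  -- `‖ψ‖` of the error stays at least `1 / 2 ≥ δ`.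
  set δ := 1 / (2 * (1 + ‖ψ u‖)) with hδ
  have hψu := norm_nonneg (ψ u)
  have hδ0 : 0 < δ := by positivity
  have hδ2 : δ * (1 + ‖ψ u‖) = 1 / 2 := by rw [hδ]; field_simp
  have hδ1 : δ ≤ 1 / 2 := by nlinarith
  obtain ⟨a, ⟨m, b, rfl⟩, ha1, ha2⟩ := hx.exists_mem (lp.evalCLM ℂ (fun _ : ℤ => ℂ) p q) ψ u hδ0
  change ‖b * (T ^ m) x q - u q‖ < δ at ha1
  rw [huq] at ha1
  have hm : (T ^ m) x q ≠ 0 := by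
    intro h0
    rw [h0] at ha1
    norm_num at ha1
    linarith
  set μ := b * (T ^ m) x q with hμ
  have hsplit : b • (T ^ m) x - u = μ • y ⟨m, (hcoord m).1 hm⟩ + (μ - 1) • u := by
    change _ = μ • (((T ^ m) x q)⁻¹ • (T ^ m) x - u) + (μ - 1) • u
    rw [smul_sub, smul_smul, hμ, mul_assoc, mul_inv_cancel₀ hm, mul_one, sub_smul, one_smul]
    abel
  rw [hsplit, map_add, map_smul, map_smul, smul_eq_mul, smul_eq_mul] at ha2
  have h1 := norm_sub_le_norm_add (μ * ψ (y ⟨m, (hcoord m).1 hm⟩)) ((μ - 1) * ψ u)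
  rw [norm_mul μ, norm_mul (μ - 1)] at h1
  have h2 : 1 - δ ≤ ‖μ‖ := by
    have := norm_sub_norm_le (1 : ℂ) (1 - μ)
    rw [norm_one, sub_sub_cancel, norm_sub_rev] at this
    linarith
  have h3 := hψ ⟨m, (hcoord m).1 hm⟩
  have h4 : ‖μ - 1‖ * ‖ψ u‖ ≤ δ * ‖ψ u‖ := by gcongr
  have h5 : ‖μ‖ ≤ ‖μ‖ * ‖ψ (y ⟨m, (hcoord m).1 hm⟩)‖ := le_mul_of_one_le_right (norm_nonneg _) h3
  linarith

end Necessity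

end LinearDynamics

namespace LinearDynamics

/-! ### Counting large coordinates. -/

section Counting

/-- Each pair of times is charged to one of its members, and each member receives at most `M`
charges; compare with the number of ordered pairs. -/
theorem card_le_of_tournament (S : Finset ℕ) (I : ℕ → Finset ℤ) (q : ℤ) (M : ℕ)
    (hM : ∀ n ∈ S, (I n).card ≤ M)
    (h : ∀ m n : ℕ, m ∈ S → n ∈ S → m < n → q + m - n ∈ I n ∨ q + n - m ∈ I m) :
    S.card ≤ 2 * M + 1 := by
  classical
  let A := (S ×ˢ S).filter fun a : ℕ × ℕ => q + a.2 - a.1 ∈ I a.1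
  let B := (S ×ˢ S).filter fun a : ℕ × ℕ => q + a.1 - a.2 ∈ I a.2
  have hrow : ∀ n ∈ S, (S.filter fun m : ℕ => q + m - n ∈ I n).card ≤ M := by
    intro n hn
    refine (Finset.card_le_card_of_injOn (fun m : ℕ => q + m - n) ?_ ?_).trans (hM n hn)
    · intro m hm
      exact (Finset.mem_filter.1 hm).2
    · intro m _ m' _ hmm
      simp only at hmm
      omega
  have hA : A.card ≤ S.card * M := by
    rw [Finset.card_filter, Finset.sum_product, ← smul_eq_mul]
    refine Finset.sum_le_card_nsmul _ _ _ fun n hn => ?_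
    rw [← Finset.card_filter]
    exact hrow n hn
  have hB : B.card ≤ S.card * M := by
    rw [Finset.card_filter, Finset.sum_product_right, ← smul_eq_mul]
    refine Finset.sum_le_card_nsmul _ _ _ fun n hn => ?_
    rw [← Finset.card_filter]
    exact hrow n hn
  have hsub : S.offDiag ⊆ A ∪ B := by
    rintro ⟨n, m⟩ hnm
    obtain ⟨hn, hm, hne⟩ := Finset.mem_offDiag.1 hnm
    simp only at hn hm hne
    rcases lt_or_gt_of_ne hne with hlt | hlt
    · rcases h n m hn hm hlt with h1 | h1
      · exact Finset.mem_union_right _ (Finset.mem_filter.2 ⟨Finset.mem_product.2 ⟨hn, hm⟩, h1⟩)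
      · exact Finset.mem_union_left _ (Finset.mem_filter.2 ⟨Finset.mem_product.2 ⟨hn, hm⟩, h1⟩)
    · rcases h m n hm hn hlt with h1 | h1
      · exact Finset.mem_union_left _ (Finset.mem_filter.2 ⟨Finset.mem_product.2 ⟨hn, hm⟩, h1⟩)
      · exact Finset.mem_union_right _ (Finset.mem_filter.2 ⟨Finset.mem_product.2 ⟨hn, hm⟩, h1⟩)
  have hcard := (Finset.card_le_card hsub).trans (Finset.card_union_le _ _)
  rw [Finset.offDiag_card] at hcard
  rcases Nat.eq_zero_or_pos S.card with h0 | h0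
  · omega
  · have h1 : S.card * S.card ≤ S.card * (2 * M + 1) := by
      have : S.card * (2 * M + 1) = S.card * M + S.card * M + S.card := by ring
      omega
    exact Nat.le_of_mul_le_mul_left h1 h0

/-- Sorted increasingly, the `k`-th nonzero value is at least `k / 3`, since `2 * N + 1 ≤ 3 * N`.
Removing a maximal element at each step compares partial sums with a convergent `p`-series. -/
theorem summable_rpow_neg_of_card_le {ι : Type*} (N : ι → ℕ)
    (h : ∀ (S : Finset ι) (M : ℕ), (∀ n ∈ S, N n ≤ M) → S.card ≤ 2 * M + 1)
    {σ : ℝ} (hσ : 1 < σ) : Summable fun n => (N n : ℝ) ^ (-σ) := by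
  classical
  have hs : Summable fun k : ℕ => (3 : ℝ) ^ σ * (k : ℝ) ^ (-σ) :=
    (Real.summable_nat_rpow.2 (by linarith)).mul_left _
  refine summable_of_sum_le (c := ∑' k : ℕ, (3 : ℝ) ^ σ * (k : ℝ) ^ (-σ))
    (fun n => by positivity) fun S => ?_
  refine le_trans ?_ (hs.sum_le_tsum (Finset.range (S.card + 1)) fun k _ => by positivity)
  induction S using Finset.induction_on_max_value N with
  | empty => simp; positivity
  | insert a S ha hmax ih =>
    rw [Finset.sum_insert ha, Finset.card_insert_of_notMem ha, Finset.sum_range_succ, add_comm]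
    refine add_le_add ih ?_
    rcases Nat.eq_zero_or_pos (N a) with h0 | h0
    -- Zero counts contribute nothing because `0 ^ (-σ) = 0` by convention.
    · rw [h0, Nat.cast_zero, Real.zero_rpow (by linarith)]
      positivity
    · have hc := h (insert a S) (N a) (by
        intro n hn
        rcases Finset.mem_insert.1 hn with rfl | hn
        · exact le_rfl
        · exact hmax n hn)
      rw [Finset.card_insert_of_notMem ha] at hc
      have hle : ((S.card + 1 : ℕ) : ℝ) / 3 ≤ N a := by
        rw [div_le_iff₀ (by norm_num)]
        have : S.card + 1 ≤ N a * 3 := by omega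
        exact_mod_cast this
      have hpos : (0 : ℝ) < ((S.card + 1 : ℕ) : ℝ) / 3 := by positivity
      refine (Real.rpow_le_rpow_of_nonpos hpos hle (by linarith)).trans (le_of_eq ?_)
      rw [Real.div_rpow (by positivity) (by norm_num), Real.rpow_neg (by norm_num : (0:ℝ) ≤ 3),
        div_inv_eq_mul, mul_comm]

end Counting

/-! ### Weakly hypercyclic shifts for `p < 2`. -/

variable {p : ℝ≥0∞} [Fact (1 ≤ p)]
  {T : lp (fun _ : ℤ => ℂ) p →L[ℂ] lp (fun _ : ℤ => ℂ) p} {β : ℤ → ℂ}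

/-- Test on the conjugate phases of `y` over `I`, a vector of norm `|I| ^ (1 / t)`. -/
theorem mul_card_rpow_le_norm_lpPairing {t r : ℝ≥0∞} [Fact (1 ≤ t)] [Fact (1 ≤ r)]
    [t.HolderConjugate r] (ht : t ≠ ∞) (h : p ≤ r) (y : lp (fun _ : ℤ => ℂ) p) (I : Finset ℤ)
    (hne : I.Nonempty) {ε : ℝ} (hI : ∀ i ∈ I, ε ≤ ‖y i‖) :
    ε * (I.card : ℝ) ^ (1 - 1 / t.toReal) ≤ ‖(lpPairing (t := t) h).flip y‖ := by
  have hτ : 0 < t.toReal := ENNReal.toReal_pos (zero_lt_one.trans_le Fact.out).ne' ht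
  have hN : (0 : ℝ) < I.card := by exact_mod_cast hne.card_pos
  let e : ℤ → ℂ := fun i => if y i = 0 then 1 else (starRingEnd ℂ) (y i) / ‖y i‖
  have he : ∀ i, ‖e i‖ = 1 := by
    intro i
    by_cases h0 : y i = 0
    · simp [e, h0]
    · simp only [e, h0, if_false, norm_div, RCLike.norm_conj, Complex.norm_real, norm_norm]
      exact div_self (norm_ne_zero_iff.2 h0)
  have hey : ∀ i, e i * y i = (‖y i‖ : ℂ) := by
    intro i
    by_cases h0 : y i = 0
    · simp [h0]
    · have h1 : (‖y i‖ : ℂ) ≠ 0 := by simpa using h0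
      simp only [e, h0, if_false]
      rw [div_mul_eq_mul_div, div_eq_iff h1, mul_comm, Complex.mul_conj,
        Complex.normSq_eq_norm_sq]
      push_cast
      ring
  set g : lp (fun _ : ℤ => ℂ) t := ∑ i ∈ I, lp.single t i (e i) with hg
  have hgn : ‖g‖ = (I.card : ℝ) ^ (1 / t.toReal) := by
    have h1 := lp.norm_sum_single hτ e I
    simp only [he, Real.one_rpow, Finset.sum_const, nsmul_eq_mul, mul_one] at h1
    rw [← h1, one_div, Real.rpow_rpow_inv (norm_nonneg _) hτ.ne']
  have h2 := ((lpPairing (t := t) h).flip y).le_opNorm g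
  have h3 : (lpPairing (t := t) h).flip y g = ((∑ i ∈ I, ‖y i‖ : ℝ) : ℂ) := by
    rw [hg, map_sum]
    push_cast
    refine Finset.sum_congr rfl fun i _ => ?_
    rw [ContinuousLinearMap.flip_apply, lpPairing_single, hey]
  rw [h3, Complex.norm_real, Real.norm_of_nonneg (Finset.sum_nonneg fun i _ => norm_nonneg _),
    hgn] at h2
  have h4 : (I.card : ℝ) * ε ≤ ∑ i ∈ I, ‖y i‖ := by
    rw [← nsmul_eq_mul]
    exact Finset.card_nsmul_le_sum _ _ _ hI
  rw [Real.rpow_sub hN, Real.rpow_one, ← mul_div_assoc, div_le_iff₀ (by positivity), mul_comm]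
  exact h4.trans h2

theorem finite_le_norm_apply (hp : p ≠ ∞) (x : lp (fun _ : ℤ => ℂ) p) {ε : ℝ} (hε : 0 < ε) :
    {i | ε ≤ ‖x i‖}.Finite := by
  have hτ : 0 < p.toReal := ENNReal.toReal_pos (zero_lt_one.trans_le Fact.out).ne' hp
  have hs := (lp.hasSum_norm hτ x).summable.tendsto_cofinite_zero
  have h1 := (hs.eventually_lt_const (Real.rpow_pos_of_pos hε p.toReal))
  refine (Filter.eventually_cofinite.1 h1).subset fun i hi => ?_
  exact not_lt.2 (Real.rpow_le_rpow hε.le hi hτ.le)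

theorem HasPotential.exists_lt_of_weaklyHypercyclic (hT : HasPotential T β) (hp2 : p < 2)
    (hw : WeaklyHypercyclic T) (q : ℤ) (ε : ℝ) (hε : 0 < ε) :
    ∃ n : ℕ, ‖β (q + n)‖ < ε ∧ ‖β (q - n)‖ < ε := by
  classical
  by_contra! hcon
  have hp : p ≠ ∞ := (hp2.trans_le (by simp)).ne
  obtain ⟨x, hx⟩ := hw
  set P := p.toReal with hP
  have hpP : p = ENNReal.ofReal P := (ENNReal.ofReal_toReal hp).symm
  have hP1 : 1 ≤ P := by
    have := ENNReal.toReal_mono hp (Fact.out : 1 ≤ p)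
    simpa using this
  have hP2 : P < 2 := by
    have := (ENNReal.toReal_lt_toReal hp (by simp)).2 hp2
    simpa using this
  -- The exponent `r` is the midpoint of `P` and `2`, hence `1 < r < 2` and its conjugate `t` is
  -- finite and above `2`, even for `P = 1`.
  let t : ℝ≥0∞ := ENNReal.ofReal ((P + 2) / P)
  let r : ℝ≥0∞ := ENNReal.ofReal ((P + 2) / 2)
  have htP : t.toReal = (P + 2) / P := ENNReal.toReal_ofReal (by positivity)
  have ht2 : 2 ≤ t.toReal := by
    rw [htP, le_div_iff₀ (by linarith)]
    linarith
  have hconj : t.HolderConjugate r := by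
    apply Real.HolderConjugate.ennrealOfReal
    rw [Real.holderConjugate_iff]
    constructor
    · rw [lt_div_iff₀ (by linarith)]
      linarith
    · field_simp
  have ht1 : Fact (1 ≤ t) := ⟨by
    rw [ENNReal.one_le_ofReal, ← htP]
    linarith⟩
  have hr1 : Fact (1 ≤ r) := ⟨by
    rw [ENNReal.one_le_ofReal]
    linarith⟩
  have hpr : p ≤ r := by
    rw [hpP]
    exact ENNReal.ofReal_le_ofReal (by linarith)
  have hβ0 : ∀ n, 0 < ‖β n‖ := fun n => norm_pos_iff.2 (hT.1 n)
  set ε' := ε / ‖β q‖ with hε'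
  have hε'0 : 0 < ε' := div_pos hε (hβ0 q)
  -- As `‖c‖ ≥ 2`, an orbit vector within `1` of `u` at coordinate `q` has that coordinate of
  -- modulus at least one.
  obtain ⟨c, hc, hc3⟩ := exists_notMem_range_dist_lt (fun n : ℕ => (T ^ n) x q) 3 one_pos
  have hc2 : 2 ≤ ‖c‖ := by
    have h1 := norm_sub_norm_le (3 : ℂ) c
    rw [dist_comm, dist_eq_norm] at hc3
    rw [show ‖(3 : ℂ)‖ = 3 by simp] at h1
    linarith
  let u : lp (fun _ : ℤ => ℂ) p := lp.single p q c
  have huq : u q = c := lp.single_apply_self _ _ _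
  have huo : ∀ i, i ≠ q → u i = 0 := fun i hi => lp.single_apply_ne _ _ _ hi
  let ι := {n : ℕ // 1 ≤ ‖(T ^ n) x q‖}
  let y : ι → lp (fun _ : ℤ => ℂ) p := fun n => (T ^ n.1) x - u
  have hyi : ∀ n i, y n i = (T ^ n.1) x i - u i := fun _ _ => rfl
  let Λ := lpPairing (p := p) (t := t) (r := r) hpr
  have hΛ0 : ∀ n, Λ.flip (y n) ≠ 0 := by
    intro n h0
    have h1 := norm_apply_le_norm_lpPairing (t := t) hpr (y n) q
    rw [show (lpPairing (t := t) hpr).flip (y n) = 0 from h0, norm_zero, hyi, huq] at h1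
    exact hc n.1 (sub_eq_zero.1 (norm_le_zero_iff.1 h1))
  let I : ℕ → Finset ℤ := fun n => (finite_le_norm_apply hp ((T ^ n) x) hε'0).toFinset.erase q
  have hmemI : ∀ n i, i ≠ q → ε' ≤ ‖(T ^ n) x i‖ → i ∈ I n := fun n i hi h =>
    Finset.mem_erase.2 ⟨hi, (Set.Finite.mem_toFinset _).2 h⟩
  -- One of `β (q ± (n - m))` has modulus at least `ε`. The minus sign makes `T ^ n x` large at `q +
  -- m - n`, the plus sign makes `T ^ m x` large at `q + n - m`.
  have htour : ∀ m n : ℕ, 1 ≤ ‖(T ^ m) x q‖ → 1 ≤ ‖(T ^ n) x q‖ → m < n →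
      q + m - n ∈ I n ∨ q + n - m ∈ I m := by
    intro m n hm hn hmn
    have hquot : ∀ k : ℕ, 1 ≤ ‖(T ^ k) x q‖ → ‖β q‖⁻¹ ≤ ‖x (q + k) / β (q + k)‖ := by
      intro k hk
      rw [hT.pow_apply hp, norm_mul] at hk
      rwa [inv_le_iff_one_le_mul₀' (hβ0 q)]
    obtain ⟨d, rfl⟩ := Nat.exists_eq_add_of_lt hmn
    rcases lt_or_ge (‖β (q + ((d + 1 : ℕ) : ℤ))‖) ε with hlt | hge
    · left
      apply hmemI
      · push_cast; omega
      · rw [hT.pow_apply hp, norm_mul]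
        have h1 := hcon (d + 1) hlt
        have h2 := hquot m hm
        rw [show q + (m : ℤ) - ((m + d + 1 : ℕ) : ℤ) = q - ((d + 1 : ℕ) : ℤ) by push_cast; ring,
          show q - ((d + 1 : ℕ) : ℤ) + ((m + d + 1 : ℕ) : ℤ) = q + m by push_cast; ring,
          hε', div_eq_mul_inv]
        exact mul_le_mul h1 h2 (by positivity) (norm_nonneg _)
    · right
      apply hmemI
      · push_cast; omega
      · rw [hT.pow_apply hp, norm_mul]
        have h2 := hquot (m + d + 1) hn
        rw [show q + ((m + d + 1 : ℕ) : ℤ) - (m : ℤ) = q + ((d + 1 : ℕ) : ℤ) by push_cast; ring,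
          show q + ((d + 1 : ℕ) : ℤ) + (m : ℤ) = q + ((m + d + 1 : ℕ) : ℤ) by push_cast; ring,
          hε', div_eq_mul_inv]
        exact mul_le_mul hge h2 (by positivity) (norm_nonneg _)
  let N : ι → ℕ := fun n => (I n.1).card
  have hcount : ∀ (S : Finset ι) (M : ℕ), (∀ n ∈ S, N n ≤ M) → S.card ≤ 2 * M + 1 := by
    intro S M hM
    rw [← Finset.card_map (Function.Embedding.subtype _)]
    refine card_le_of_tournament _ I q M ?_ ?_
    · intro n hn
      obtain ⟨n', hn', rfl⟩ := Finset.mem_map.1 hn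
      exact hM n' hn'
    · intro m n hm hn hmn
      obtain ⟨m', _, rfl⟩ := Finset.mem_map.1 hm
      obtain ⟨n', _, rfl⟩ := Finset.mem_map.1 hn
      exact htour _ _ m'.2 n'.2 hmn
  -- This exponent is `2 * (1 - 1 / t) = 2 / r`; it exceeds one exactly because `P < 2`.
  have hσ : 1 < 4 / (P + 2) := by
    rw [lt_div_iff₀ (by linarith)]
    linarith
  have hNsum := (summable_rpow_neg_of_card_le N hcount hσ).mul_left (ε' ^ 2)⁻¹
  have hsum : Summable fun n => (‖Λ.flip (y n)‖ ^ 2)⁻¹ := by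
    refine hNsum.of_norm_bounded_eventually ?_
    have hfin : {n : ι | N n = 0}.Finite := by
      by_contra hinf
      obtain ⟨S, hS, hcard⟩ := Set.Infinite.exists_subset_card_eq hinf 2
      have := hcount S 0 fun n hn => (hS hn : N n = 0).le
      omega
    filter_upwards [hfin.compl_mem_cofinite] with n hn
    have hn0 : 0 < N n := Nat.pos_of_ne_zero hn
    have hNpos : (0 : ℝ) < N n := by exact_mod_cast hn0
    have hlow : ε' * (N n : ℝ) ^ (1 - 1 / t.toReal) ≤ ‖Λ.flip (y n)‖ := by
      refine mul_card_rpow_le_norm_lpPairing ENNReal.ofReal_ne_top hpr (y n) (I n.1)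
        (Finset.card_pos.1 hn0) ?_
      intro i hi
      obtain ⟨hiq, hi⟩ := Finset.mem_erase.1 hi
      rw [hyi, huo i hiq, sub_zero]
      exact (Set.Finite.mem_toFinset (finite_le_norm_apply hp ((T ^ n.1) x) hε'0)).1 hi
    have hNσ : 0 < (N n : ℝ) ^ (4 / (P + 2)) := Real.rpow_pos_of_pos hNpos _
    rw [Real.norm_of_nonneg (inv_nonneg.2 (sq_nonneg _)), Real.rpow_neg hNpos.le, ← mul_inv]
    refine inv_anti₀ (mul_pos (pow_pos hε'0 2) hNσ) ?_
    have h1 := pow_le_pow_left₀ (mul_pos hε'0 (Real.rpow_pos_of_pos hNpos _)).le hlow 2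
    rw [mul_pow, ← Real.rpow_natCast ((N n : ℝ) ^ _) 2, ← Real.rpow_mul hNpos.le] at h1
    convert h1 using 3
    rw [htP]
    push_cast
    field_simp
    ring
  obtain ⟨K, hK, hsmooth⟩ := exists_quadraticallySmooth_lp t ht2
  obtain ⟨ψ, hψ⟩ := hsmooth.exists_dual_one_le hK Λ y hΛ0 hsum
  obtain ⟨a, ⟨m, rfl⟩, ha1, ha2⟩ := hx.exists_mem (lp.evalCLM ℂ (fun _ : ℤ => ℂ) p q) ψ u one_pos
  change ‖(T ^ m) x q - u q‖ < 1 at ha1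
  rw [huq] at ha1
  have hm : 1 ≤ ‖(T ^ m) x q‖ := by
    have h1 := norm_sub_norm_le c ((T ^ m) x q)
    rw [norm_sub_rev] at h1
    linarith
  have h1 := hψ ⟨m, hm⟩
  exact absurd ha2 (not_lt.2 h1)

end LinearDynamics

namespace LinearDynamics

/-! ### A Baire category criterion for weak density. -/

section WeakUniversality

open TopologicalSpace

variable {X : Type*} [NormedAddCommGroup X] [NormedSpace ℂ X]

/-- The vectors `x` for which some finite combination of the errors `f k x - v` is small, uniformly
in the phases, compared with `1 / M` times the sum of its coefficients. -/
def weakApproxSet {κ : Type*} (f : κ → X →L[ℂ] X) (v : X) (M : ℕ) : Set X :=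
  {x | ∃ (F : Finset ℕ) (τ : ℕ → κ) (a : ℕ → ℝ) (B : ℝ), (∀ k ∈ F, 0 ≤ a k) ∧
    (∀ θ : ℕ → ℂ, (∀ k, ‖θ k‖ ≤ 1) → ‖∑ k ∈ F, ((a k : ℂ) * θ k) • (f (τ k) x - v)‖ ≤ B) ∧
    M * B < ∑ k ∈ F, a k}

theorem isOpen_weakApproxSet {κ : Type*} (f : κ → X →L[ℂ] X) (v : X) (M : ℕ) :
    IsOpen (weakApproxSet f v M) := by
  rw [isOpen_iff_mem_nhds]
  rintro x ⟨F, τ, a, B, ha, hB, hlt⟩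
  -- The data `F`, `τ`, `a` are kept; only the bound `B` grows, continuously in `z`.
  have hc : Continuous fun z => M * (B + ∑ k ∈ F, a k * ‖f (τ k) z - f (τ k) x‖) := by
    fun_prop
  have hev : ∀ᶠ z in nhds x, M * (B + ∑ k ∈ F, a k * ‖f (τ k) z - f (τ k) x‖) < ∑ k ∈ F, a k := by
    refine hc.continuousAt.eventually_lt_const ?_
    simpa using hlt
  filter_upwards [hev] with z hz
  refine ⟨F, τ, a, _, ha, fun θ hθ => ?_, hz⟩
  have hsplit : ∑ k ∈ F, ((a k : ℂ) * θ k) • (f (τ k) z - v) =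
      ∑ k ∈ F, ((a k : ℂ) * θ k) • (f (τ k) x - v) +
        ∑ k ∈ F, ((a k : ℂ) * θ k) • (f (τ k) z - f (τ k) x) := by
    rw [← Finset.sum_add_distrib]
    refine Finset.sum_congr rfl fun k _ => ?_
    rw [← smul_add]
    congr 1
    abel
  rw [hsplit]
  refine (norm_add_le _ _).trans (add_le_add (hB θ hθ) ((norm_sum_le _ _).trans ?_))
  refine Finset.sum_le_sum fun k hk => ?_
  rw [norm_smul, norm_mul, Complex.norm_real, Real.norm_of_nonneg (ha k hk)]
  have := ha k hk
  gcongr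
  exact mul_le_of_le_one_right this (hθ k)

/-- A weak analogue of Birkhoff's transitivity argument. -/
theorem exists_weaklyDense_range [CompleteSpace X] [SeparableSpace X] {κ : Type*}
    (f : κ → X →L[ℂ] X) {S : Set X} (hS : Dense S)
    (h : ∀ u ∈ S, ∀ v ∈ S, ∀ η > 0, ∀ M : ℕ, ∃ z, dist z u < η ∧ z ∈ weakApproxSet f v M) :
    ∃ x, WeaklyDense (Set.range fun k => f k x) := by
  obtain ⟨D, hDS, hDc, hD⟩ := hS.exists_countable_dense_subset
  have := hDc.to_subtype
  have hdense : ∀ vm : D × ℕ, Dense (weakApproxSet f (vm.1 : X) vm.2) := by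
    intro vm
    refine Metric.dense_iff.2 fun x r hr => ?_
    obtain ⟨u, huS, hu⟩ := hS.exists_dist_lt x (half_pos hr)
    obtain ⟨z, hz, hzG⟩ := h u huS vm.1 (hDS vm.1.2) (r / 2) (half_pos hr) vm.2
    refine ⟨z, ?_, hzG⟩
    rw [Metric.mem_ball]
    calc dist z x ≤ dist z u + dist x u := dist_triangle_right _ _ _
      _ < r := by linarith
  obtain ⟨x, hx⟩ := (dense_iInter_of_isOpen
    (fun vm : D × ℕ => isOpen_weakApproxSet f (vm.1 : X) vm.2) hdense).nonempty
  refine ⟨x, weaklyDense_of_forall_finset hD fun v hv Φ δ hδ => ?_⟩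
  obtain ⟨M, hM⟩ := exists_nat_gt ((∑ φ ∈ Φ, ‖φ‖) / δ)
  obtain ⟨F, τ, a, B, ha, hB, hlt⟩ := Set.mem_iInter.1 hx (⟨v, hv⟩, M)
  have hB0 : 0 ≤ B := by simpa using hB 0 (by simp)
  obtain ⟨k, -, hk⟩ := exists_forall_norm_apply_lt (fun k => f (τ k) x - v) Φ (δ := δ) F a ha hB
    (by
      rw [div_lt_iff₀ hδ] at hM
      calc (∑ φ ∈ Φ, ‖φ‖) * B ≤ M * δ * B := by gcongr
        _ = δ * (M * B) := by ring
        _ < _ := mul_lt_mul_of_pos_left hlt hδ)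
  exact ⟨f (τ k) x, Set.mem_range_self _, hk⟩

end WeakUniversality

/-! ### Trial vectors and estimates of their errors. -/

section Construction

variable {p : ℝ≥0∞} [Fact (1 ≤ p)]

theorem toReal_pos_of_ne_top (hp : p ≠ ∞) : 0 < p.toReal :=
  ENNReal.toReal_pos (zero_lt_one.trans_le Fact.out).ne' hp

theorem exists_hasPotential (hp : p ≠ ∞) {β : ℤ → ℂ} (hβ0 : ∀ n, β n ≠ 0) {C : ℝ}
    (hC0 : 0 ≤ C) (hC : ∀ n, ‖β n‖ ≤ C * ‖β (n + 1)‖) :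
    ∃ T : lp (fun _ : ℤ => ℂ) p →L[ℂ] lp (fun _ : ℤ => ℂ) p,
      HasPotential T β ∧ IsBilateralWeightedShift T := by
  have hP := toReal_pos_of_ne_top hp
  have hw : ∀ n, ‖β n / β (n + 1)‖ ≤ C := fun n => by
    rw [norm_div, div_le_iff₀ (norm_pos_iff.2 (hβ0 _))]
    exact hC n
  have hsum : ∀ (x : lp (fun _ : ℤ => ℂ) p) (s : Finset ℤ),
      ∑ i ∈ s, ‖β i / β (i + 1) * x (i + 1)‖ ^ p.toReal ≤ (C * ‖x‖) ^ p.toReal := by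
    intro x s
    calc ∑ i ∈ s, ‖β i / β (i + 1) * x (i + 1)‖ ^ p.toReal
        ≤ ∑ i ∈ s, C ^ p.toReal * ‖x (i + 1)‖ ^ p.toReal := by
          refine Finset.sum_le_sum fun i _ => ?_
          rw [norm_mul, Real.mul_rpow (norm_nonneg _) (norm_nonneg _)]
          have := Real.rpow_le_rpow (norm_nonneg _) (hw i) hP.le
          gcongr
      _ = C ^ p.toReal * ∑ i ∈ s.map (Equiv.addRight (1 : ℤ)).toEmbedding,
            ‖x i‖ ^ p.toReal := by
          rw [← Finset.mul_sum, Finset.sum_map]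
          rfl
      _ ≤ C ^ p.toReal * ‖x‖ ^ p.toReal := by
          gcongr
          exact lp.sum_rpow_le_norm_rpow hP x _
      _ = _ := (Real.mul_rpow hC0 (norm_nonneg _)).symm
  let L : lp (fun _ : ℤ => ℂ) p →ₗ[ℂ] lp (fun _ : ℤ => ℂ) p :=
    { toFun := fun x => ⟨fun i => β i / β (i + 1) * x (i + 1), memℓp_gen' (hsum x)⟩
      map_add' := fun x y => by
        ext i
        exact mul_add _ _ _
      map_smul' := fun c x => by
        ext i
        exact mul_left_comm _ _ _ }
  let T := L.mkContinuous C fun x => lp.norm_le_of_forall_sum_le hP (by positivity) (hsum x)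
  have hTa : ∀ x i, T x i = β i / β (i + 1) * x (i + 1) := fun _ _ => rfl
  have hTs : ∀ n (c : ℂ), T (lp.single p n c) = lp.single p (n - 1) (β (n - 1) / β n * c) := by
    intro n c
    ext i
    rw [hTa]
    rcases eq_or_ne i (n - 1) with rfl | hi
    · rw [sub_add_cancel, lp.single_apply_self, lp.single_apply_self]
    · rw [lp.single_apply_ne _ _ _ (by omega), lp.single_apply_ne _ _ _ hi, mul_zero]
  refine ⟨T, ⟨hβ0, fun n => ?_⟩, fun n => β (n - 1) / β n,
    fun n => div_ne_zero (hβ0 _) (hβ0 _), ⟨C, fun n => ?_⟩, fun n => ?_⟩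
  · rw [hTs, div_mul_cancel₀ _ (hβ0 _)]
  · have := hw (n - 1)
    rwa [sub_add_cancel] at this
  · rw [hTs, smul_lp_single]

theorem norm_sum_single_of_injOn (hp : p ≠ ∞) {σ : Type*} (s : Finset σ) (π : σ → ℤ)
    (hπ : Set.InjOn π s) (c : σ → ℂ) :
    ‖∑ τ ∈ s, (lp.single p (π τ) (c τ) : lp (fun _ : ℤ => ℂ) p)‖ =
      (∑ τ ∈ s, ‖c τ‖ ^ p.toReal) ^ (1 / p.toReal) := by
  classical
  have hP := toReal_pos_of_ne_top hp
  rcases s.eq_empty_or_nonempty with rfl | ⟨τ₀, _⟩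
  · simp [Real.zero_rpow (inv_ne_zero hP.ne')]
  have : Nonempty σ := ⟨τ₀⟩
  have hinv := hπ.leftInvOn_invFunOn
  have h1 := lp.norm_sum_single (E := fun _ : ℤ => ℂ) hP
    (fun j => c (Function.invFunOn π s j)) (s.image π)
  rw [Finset.sum_image hπ, Finset.sum_image hπ] at h1
  have h2 : ∑ τ ∈ s, (lp.single p (π τ) (c (Function.invFunOn π s (π τ))) :
      lp (fun _ : ℤ => ℂ) p) = ∑ τ ∈ s, lp.single p (π τ) (c τ) :=
    Finset.sum_congr rfl fun τ hτ => by rw [hinv hτ]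
  have h3 : ∑ τ ∈ s, ‖c (Function.invFunOn π s (π τ))‖ ^ p.toReal = ∑ τ ∈ s, ‖c τ‖ ^ p.toReal :=
    Finset.sum_congr rfl fun τ hτ => by rw [hinv hτ]
  rw [h2, h3] at h1
  rw [← h1, one_div, Real.rpow_rpow_inv (norm_nonneg _) hP.ne']

/-- A weighted `ℓ_1`-norm on finitely supported sequences. -/
noncomputable def weightedNorm (A : ℤ → ℝ) (v : ℤ →₀ ℂ) : ℝ := ∑ i ∈ v.support, ‖v i‖ * A i

theorem weightedNorm_nonneg {A : ℤ → ℝ} (hA : ∀ i, 0 ≤ A i) (v : ℤ →₀ ℂ) :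
    0 ≤ weightedNorm A v :=
  Finset.sum_nonneg fun i _ => mul_nonneg (norm_nonneg _) (hA i)

variable {β : ℤ → ℂ} {A ρ : ℤ → ℝ}

/-- For fixed `i` the positions `i - m τ` are distinct, so the norm is an exact `ℓ_p` sum; the
triangle inequality is spent only on the support of `v`. -/
theorem norm_sum_smul_shiftComb_le (hp : p ≠ ∞) (hA : ∀ i, 0 ≤ A i) (hρ : ∀ m, 0 ≤ ρ m)
    (hβ : ∀ i m, ‖β (i - m)‖ ≤ A i * ρ m) {σ : Type*} (s : Finset σ) (m : σ → ℤ)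
    (hm : Set.InjOn m s) (γ : σ → ℂ) (b : σ → ℝ) (hγ : ∀ τ ∈ s, ‖γ τ‖ ≤ b τ) (v : ℤ →₀ ℂ) :
    ‖∑ τ ∈ s, γ τ • shiftComb p β (m τ) v‖ ≤
      weightedNorm A v * (∑ τ ∈ s, (b τ * ρ (m τ)) ^ p.toReal) ^ (1 / p.toReal) := by
  have hP := toReal_pos_of_ne_top hp
  have h1 : ∑ τ ∈ s, γ τ • shiftComb p β (m τ) v = ∑ i ∈ v.support, v i •
      ∑ τ ∈ s, (lp.single p (i - m τ) (γ τ * β (i - m τ)) : lp (fun _ : ℤ => ℂ) p) := by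
    simp only [shiftComb_apply, Finset.smul_sum, smul_lp_single]
    rw [Finset.sum_comm]
    refine Finset.sum_congr rfl fun i _ => Finset.sum_congr rfl fun τ _ => ?_
    rw [mul_left_comm]
  rw [h1, weightedNorm, Finset.sum_mul]
  refine (norm_sum_le _ _).trans (Finset.sum_le_sum fun i _ => ?_)
  rw [norm_smul, mul_assoc]
  gcongr
  rw [norm_sum_single_of_injOn hp s _ (fun τ hτ τ' hτ' h => hm hτ hτ' (by simpa using h))]
  have hb : ∀ τ ∈ s, 0 ≤ b τ := fun τ hτ => (norm_nonneg _).trans (hγ τ hτ)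
  have h2 : ∑ τ ∈ s, ‖γ τ * β (i - m τ)‖ ^ p.toReal ≤
      A i ^ p.toReal * ∑ τ ∈ s, (b τ * ρ (m τ)) ^ p.toReal := by
    rw [Finset.mul_sum]
    refine Finset.sum_le_sum fun τ hτ => ?_
    have h0 := hb τ hτ
    have h0' := hρ (m τ)
    rw [← Real.mul_rpow (hA i) (by positivity), norm_mul]
    refine Real.rpow_le_rpow (by positivity) ?_ hP.le
    calc ‖γ τ‖ * ‖β (i - m τ)‖ ≤ b τ * (A i * ρ (m τ)) :=
          mul_le_mul (hγ τ hτ) (hβ i (m τ)) (norm_nonneg _) h0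
      _ = _ := by ring
  have h3 : 0 ≤ ∑ τ ∈ s, (b τ * ρ (m τ)) ^ p.toReal := Finset.sum_nonneg fun τ hτ =>
    Real.rpow_nonneg (mul_nonneg (hb τ hτ) (hρ _)) _
  refine (Real.rpow_le_rpow (Finset.sum_nonneg fun τ _ => by positivity) h2
    (by positivity)).trans (le_of_eq ?_)
  rw [Real.mul_rpow (Real.rpow_nonneg (hA i) _) h3, one_div, Real.rpow_rpow_inv (hA i) hP.ne']

variable {T : lp (fun _ : ℤ => ℂ) p →L[ℂ] lp (fun _ : ℤ => ℂ) p}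

/-- The diagonal terms `j = k` reproduce the target and cancel. What remains is the image of `ξ` and
the cross terms, shifted by the distinct differences `n k - n j`. -/
theorem HasPotential.norm_sum_error_le (hT : HasPotential T β) (hp : p ≠ ∞) (hA : ∀ i, 0 ≤ A i)
    (hρ : ∀ m, 0 ≤ ρ m) (hβ : ∀ i m, ‖β (i - m)‖ ≤ A i * ρ m) (ξ ν : ℤ →₀ ℂ) (F : Finset ℕ)
    (n : ℕ → ℕ) (hn : Function.Injective n)
    (hn2 : Set.InjOn (fun x : ℕ × ℕ => (n x.1 : ℤ) - n x.2) F.offDiag) (c : ℕ → ℝ)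
    (hc : ∀ k ∈ F, 0 < c k) (a : ℕ → ℝ) (ha : ∀ k ∈ F, 0 ≤ a k) (θ : ℕ → ℂ)
    (hθ : ∀ k, ‖θ k‖ ≤ 1) :
    ‖∑ k ∈ F, ((a k : ℂ) * θ k) • (((c k : ℂ)⁻¹ • T ^ n k) (shiftComb p β 0 ξ +
        ∑ j ∈ F, (c j : ℂ) • shiftComb p β (-n j) ν) - shiftComb p β 0 ν)‖ ≤
      weightedNorm A ξ * (∑ k ∈ F, (a k / c k * ρ (n k)) ^ p.toReal) ^ (1 / p.toReal) +
      weightedNorm A ν * (∑ x ∈ F.offDiag,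
        (a x.1 / c x.1 * c x.2 * ρ (n x.1 - n x.2)) ^ p.toReal) ^ (1 / p.toReal) := by
  classical
  have hterm : ∀ k ∈ F, ((a k : ℂ) * θ k) • (((c k : ℂ)⁻¹ • T ^ n k) (shiftComb p β 0 ξ +
        ∑ j ∈ F, (c j : ℂ) • shiftComb p β (-n j) ν) - shiftComb p β 0 ν) =
      ((a k : ℂ) * θ k * (c k : ℂ)⁻¹) • shiftComb p β (n k) ξ +
        ∑ j ∈ F.erase k, ((a k : ℂ) * θ k * (c k : ℂ)⁻¹ * c j) •
          shiftComb p β ((n k : ℤ) - n j) ν := by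
    intro k hk
    have hck : (c k : ℂ) ≠ 0 := by exact_mod_cast (hc k hk).ne'
    rw [smul_apply, map_add, hT.pow_shiftComb, map_sum, zero_add,
      ← Finset.add_sum_erase _ _ hk, map_smul, hT.pow_shiftComb, neg_add_cancel, smul_add,
      smul_add, inv_smul_smul₀ hck, ← add_assoc, add_right_comm, add_sub_cancel_right, smul_add,
      smul_smul, Finset.smul_sum, Finset.smul_sum]
    congr 1
    refine Finset.sum_congr rfl fun j _ => ?_
    rw [map_smul, hT.pow_shiftComb, smul_smul, smul_smul, neg_add_eq_sub]
  rw [Finset.sum_congr rfl hterm, Finset.sum_add_distrib]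
  have hcoef : ∀ k ∈ F, ‖(a k : ℂ) * θ k * (c k : ℂ)⁻¹‖ ≤ a k / c k := by
    intro k hk
    rw [norm_mul, norm_mul, norm_inv, Complex.norm_real, Complex.norm_real,
      Real.norm_of_nonneg (ha k hk), Real.norm_of_nonneg (hc k hk).le, div_eq_mul_inv]
    have h1 := hc k hk
    gcongr
    exact mul_le_of_le_one_right (ha k hk) (hθ k)
  refine (norm_add_le _ _).trans (add_le_add ?_ ?_)
  · exact norm_sum_smul_shiftComb_le hp hA hρ hβ F (fun k => (n k : ℤ))
      (fun k _ k' _ h => hn (Int.ofNat_inj.1 h)) _ _ hcoef ξ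
  · have hoff : ∑ k ∈ F, ∑ j ∈ F.erase k, ((a k : ℂ) * θ k * (c k : ℂ)⁻¹ * c j) •
          shiftComb p β ((n k : ℤ) - n j) ν =
        ∑ x ∈ F.offDiag, ((a x.1 : ℂ) * θ x.1 * (c x.1 : ℂ)⁻¹ * c x.2) •
          shiftComb p β ((n x.1 : ℤ) - n x.2) ν := by
      rw [Finset.sum_sigma']
      refine Finset.sum_bij' (fun x _ => (x.1, x.2)) (fun x _ => ⟨x.1, x.2⟩) ?_ ?_ ?_ ?_ ?_
      · rintro ⟨k, j⟩ h
        simp only [Finset.mem_sigma, Finset.mem_erase] at h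
        exact Finset.mem_offDiag.2 ⟨h.1, h.2.2, fun e => h.2.1 e.symm⟩
      · rintro ⟨k, j⟩ h
        obtain ⟨h1, h2, h3⟩ := Finset.mem_offDiag.1 h
        simp only [Finset.mem_sigma, Finset.mem_erase]
        exact ⟨h1, fun e => h3 e.symm, h2⟩
      · intros; rfl
      · intros; rfl
      · intros; rfl
    rw [hoff]
    refine norm_sum_smul_shiftComb_le hp hA hρ hβ F.offDiag (fun x => (n x.1 : ℤ) - n x.2)
      hn2 _ (fun x => a x.1 / c x.1 * c x.2) ?_ ν
    intro x hx
    obtain ⟨h1, h2, -⟩ := Finset.mem_offDiag.1 hx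
    rw [norm_mul, Complex.norm_real, Real.norm_of_nonneg (hc _ h2).le]
    exact mul_le_mul_of_nonneg_right (hcoef _ h1) (hc _ h2).le

/-- Powers of `4` form a Sidon set: distinct ones differ by a factor of at least `4`, which excludes
coincidences of two-term sums. -/
theorem injOn_four_pow_sub {N : ℕ} (hN : 0 < N) (F : Finset ℕ) :
    Set.InjOn (fun x : ℕ × ℕ => ((N * 4 ^ x.1 : ℕ) : ℤ) - (N * 4 ^ x.2 : ℕ)) F.offDiag := by
  have hcmp : ∀ a b : ℕ, a < b → 4 * 4 ^ a ≤ 4 ^ b := fun a b h => by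
    rw [← pow_succ']
    exact Nat.pow_le_pow_right (by norm_num) h
  rintro ⟨k, j⟩ hkj ⟨k', j'⟩ hkj' h
  obtain ⟨-, -, hne⟩ := Finset.mem_offDiag.1 hkj
  obtain ⟨-, -, hne'⟩ := Finset.mem_offDiag.1 hkj'
  simp only at hne hne' h
  have h1 : (N : ℤ) * ((4 ^ k : ℕ) + (4 ^ j' : ℕ)) = N * ((4 ^ k' : ℕ) + (4 ^ j : ℕ)) := by
    push_cast at h ⊢
    linear_combination h
  have h2 : 4 ^ k + 4 ^ j' = 4 ^ k' + 4 ^ j := by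
    have := mul_left_cancel₀ (by exact_mod_cast hN.ne') h1
    exact_mod_cast this
  have hk : k = k' ∨ 4 * 4 ^ k ≤ 4 ^ k' ∨ 4 * 4 ^ k' ≤ 4 ^ k := by
    rcases lt_trichotomy k k' with h | h | h
    · exact Or.inr (Or.inl (hcmp _ _ h))
    · exact Or.inl h
    · exact Or.inr (Or.inr (hcmp _ _ h))
  have hj : j = j' ∨ 4 * 4 ^ j ≤ 4 ^ j' ∨ 4 * 4 ^ j' ≤ 4 ^ j := by
    rcases lt_trichotomy j j' with h | h | h
    · exact Or.inr (Or.inl (hcmp _ _ h))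
    · exact Or.inl h
    · exact Or.inr (Or.inr (hcmp _ _ h))
  have hkj1 : 4 * 4 ^ k ≤ 4 ^ j ∨ 4 * 4 ^ j ≤ 4 ^ k := by
    rcases lt_or_gt_of_ne hne with h | h
    · exact Or.inl (hcmp _ _ h)
    · exact Or.inr (hcmp _ _ h)
  have hkj2 : 4 * 4 ^ k' ≤ 4 ^ j' ∨ 4 * 4 ^ j' ≤ 4 ^ k' := by
    rcases lt_or_gt_of_ne hne' with h | h
    · exact Or.inl (hcmp _ _ h)
    · exact Or.inr (hcmp _ _ h)
  have p1 : 0 < 4 ^ k := by positivity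
  have p2 : 0 < 4 ^ j := by positivity
  have p3 : 0 < 4 ^ k' := by positivity
  have p4 : 0 < 4 ^ j' := by positivity
  rcases hk with rfl | hk
  · rcases hj with rfl | hj
    · rfl
    · exfalso; omega
  · exfalso
    rcases hj with rfl | hj <;> omega

theorem injective_mul_four_pow {N : ℕ} (hN : 0 < N) :
    Function.Injective fun k : ℕ => N * 4 ^ k := fun k k' h =>
  Nat.pow_right_injective (le_refl 2 |>.trans (by norm_num : 2 ≤ 4))
    (Nat.eq_of_mul_eq_mul_left hN h)

end Construction

end LinearDynamics

namespace LinearDynamics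

theorem offDiag_subset_product {σ : Type*} [DecidableEq σ] (F : Finset σ) :
    F.offDiag ⊆ F ×ˢ F := fun x hx => by
  obtain ⟨h1, h2, -⟩ := Finset.mem_offDiag.1 hx
  exact Finset.mem_product.2 ⟨h1, h2⟩

/-! ### The unweighted shift: counterexample for `p > 2`. -/

section Unweighted

variable {p : ℝ≥0∞} [Fact (1 ≤ p)]
  {T : lp (fun _ : ℤ => ℂ) p →L[ℂ] lp (fun _ : ℤ => ℂ) p}

/-- Approximating `e_0` forces one coordinate of `x` to exceed all others by a factor of `3`;
approximating `e_0 + e_1` gives two coordinates of at least `3/5` of any coordinate. -/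
theorem HasPotential.not_supercyclic_of_one (hT : HasPotential T fun _ => 1) (hp : p ≠ ∞) :
    ¬ Supercyclic T := by
  rintro ⟨x, hx⟩
  have hp0 : p ≠ 0 := (zero_lt_one.trans_le Fact.out).ne'
  have key : ∀ z : lp (fun _ : ℤ => ℂ) p, ∃ (n : ℕ) (c : ℂ), ∀ k, ‖c * x (k + n) - z k‖ < 1 / 4 := by
    intro z
    obtain ⟨y, ⟨n, c, rfl⟩, hy⟩ := hx.exists_dist_lt z (show (0 : ℝ) < 1 / 4 by norm_num)
    refine ⟨n, c, fun k => ?_⟩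
    rw [dist_comm, dist_eq_norm] at hy
    have h1 := (lp.norm_apply_le_norm hp0 (c • (T ^ n) x - z) k).trans_lt hy
    rw [lp.coeFn_sub, Pi.sub_apply, lp.coeFn_smul, Pi.smul_apply, hT.pow_apply hp] at h1
    simpa using h1
  obtain ⟨n, c, hc⟩ := key (lp.single p 0 1)
  obtain ⟨m, d, hd⟩ := key (lp.single p 0 1 + lp.single p 1 1)
  have hcn : 3 / 4 < ‖c‖ * ‖x n‖ := by
    have h := hc 0
    rw [lp.single_apply_self, zero_add] at h
    have h' := norm_sub_norm_le (1 : ℂ) (c * x n)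
    rw [norm_sub_rev, norm_one, norm_mul] at h'
    linarith
  have hcj : ∀ j : ℤ, j ≠ n → ‖c‖ * ‖x j‖ < 1 / 4 := by
    intro j hj
    have h := hc (j - n)
    rwa [lp.single_apply_ne _ _ _ (sub_ne_zero.2 hj), sub_add_cancel, sub_zero, norm_mul] at h
  have hd1 : ∀ j : ℤ, ‖d‖ * ‖x j‖ < 5 / 4 := by
    intro j
    have h := hd (j - m)
    rw [sub_add_cancel, lp.coeFn_add, Pi.add_apply] at h
    have hz : ‖(lp.single p 0 (1 : ℂ) : lp (fun _ : ℤ => ℂ) p) (j - m) +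
        (lp.single p 1 (1 : ℂ) : lp (fun _ : ℤ => ℂ) p) (j - m)‖ ≤ 1 := by
      rcases eq_or_ne (j - m) 0 with h0 | h0
      · rw [h0, lp.single_apply_self, lp.single_apply_ne _ _ _ (by norm_num)]
        simp
      rcases eq_or_ne (j - m) 1 with h1 | h1
      · rw [h1, lp.single_apply_self, lp.single_apply_ne _ _ _ (by norm_num)]
        simp
      rw [lp.single_apply_ne _ _ _ h0, lp.single_apply_ne _ _ _ h1]
      simp
    have h' := norm_le_norm_add_norm_sub' (d * x j) ((lp.single p 0 (1 : ℂ) :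
      lp (fun _ : ℤ => ℂ) p) (j - m) + (lp.single p 1 (1 : ℂ) : lp (fun _ : ℤ => ℂ) p) (j - m))
    rw [norm_mul] at h'
    linarith
  have hd2 : ∀ k : ℤ, k = 0 ∨ k = 1 → 3 / 4 < ‖d‖ * ‖x (k + m)‖ := by
    intro k hk
    have h := hd k
    have hz : (lp.single p 0 (1 : ℂ) + lp.single p 1 (1 : ℂ) : lp (fun _ : ℤ => ℂ) p) k = 1 := by
      rw [lp.coeFn_add, Pi.add_apply]
      rcases hk with rfl | rfl
      · rw [lp.single_apply_self, lp.single_apply_ne _ _ _ (by norm_num), add_zero]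
      · rw [lp.single_apply_self, lp.single_apply_ne _ _ _ (by norm_num), zero_add]
    rw [hz] at h
    have h' := norm_sub_norm_le (1 : ℂ) (d * x (k + m))
    rw [norm_sub_rev, norm_one, norm_mul] at h'
    linarith
  obtain ⟨k, hk, hkn⟩ : ∃ k : ℤ, (k = 0 ∨ k = 1) ∧ k + m ≠ n := by
    by_cases h : (0 : ℤ) + m = n
    · exact ⟨1, Or.inr rfl, by omega⟩
    · exact ⟨0, Or.inl rfl, h⟩
  have h1 := hcj _ hkn
  have h2 := hd2 k hk
  have h3 := hd1 n
  have h4 : (3 / 4) * (3 / 4) < (‖d‖ * ‖x (k + m)‖) * (‖c‖ * ‖x n‖) :=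
    mul_lt_mul h2 hcn.le (by norm_num) (by positivity)
  have h5 : (‖c‖ * ‖x (k + m)‖) * (‖d‖ * ‖x n‖) ≤ (1 / 4) * (5 / 4) :=
    mul_le_mul h1.le h3.le (by positivity) (by norm_num)
  linarith [show (‖d‖ * ‖x (k + m)‖) * (‖c‖ * ‖x n‖) = (‖c‖ * ‖x (k + m)‖) * (‖d‖ * ‖x n‖) by ring]

/-- With `r k = (k + 1) ^ (-1/2)`, take `c k = ε * r k` and `a k = r k ^ 2`. As `P > 2`, `r` lies in
`ℓ_P`, so the perturbation is small with `ε` and the error bound does not depend on `K`, while `∑ a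
k` is the divergent harmonic series. -/
theorem HasPotential.weaklySupercyclic_of_one (hT : HasPotential T fun _ => 1) (hp : p ≠ ∞)
    (hp2 : 2 < p) : WeaklySupercyclic T := by
  have := separableSpace_lp (p := p) hp
  have hP2 : 2 < p.toReal := by
    simpa using (ENNReal.toReal_lt_toReal (by simp) hp).2 hp2
  have hP := toReal_pos_of_ne_top hp
  set P := p.toReal
  suffices h : ∃ x, WeaklyDense (Set.range fun k : ℕ × ℂ => (k.2 • T ^ k.1) x) by
    obtain ⟨x, hx⟩ := h
    refine ⟨x, ?_⟩
    convert hx using 1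
    ext y
    exact ⟨fun ⟨n, c, h⟩ => ⟨(n, c), h.symm⟩, fun ⟨k, h⟩ => ⟨k.1, k.2, h.symm⟩⟩
  refine exists_weaklyDense_range _ (denseRange_shiftComb hp hT.1) ?_
  rintro _ ⟨ξ, rfl⟩ _ ⟨ν, rfl⟩ η hη M
  let r : ℕ → ℝ := fun k => ((k : ℝ) + 1) ^ (-(1 / 2) : ℝ)
  have hr : ∀ k, 0 < r k := fun k => Real.rpow_pos_of_pos (by positivity) _
  have hr2 : ∀ k, r k * r k = 1 / ((k : ℝ) + 1) := fun k => by
    rw [← Real.rpow_add (by positivity), one_div ((k : ℝ) + 1), ← Real.rpow_neg_one]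
    norm_num
  have hsum : Summable fun k => r k ^ P := by
    have h1 := (summable_nat_add_iff 1).2 (Real.summable_nat_rpow.2
      (show -(1 / 2) * P < -1 by linarith))
    refine h1.congr fun k => ?_
    rw [Real.rpow_mul (by positivity), Nat.cast_add_one]
  obtain ⟨Q, hQ0, hQ⟩ : ∃ Q : ℝ, 0 ≤ Q ∧ ∀ F : Finset ℕ, ∑ k ∈ F, r k ^ P ≤ Q :=
    ⟨_, tsum_nonneg fun k => (Real.rpow_pos_of_pos (hr k) _).le, fun F =>
      hsum.sum_le_tsum F fun k _ => (Real.rpow_pos_of_pos (hr k) _).le⟩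
  have hA : ∀ i : ℤ, (0 : ℝ) ≤ (fun _ => 1) i := fun _ => zero_le_one
  have hβ : ∀ i m : ℤ, ‖(fun _ => 1 : ℤ → ℂ) (i - m)‖ ≤ (fun _ => (1 : ℝ)) i * (fun _ => (1 : ℝ)) m :=
    fun _ _ => by simp
  set κ := weightedNorm (fun _ => 1) ν
  have hκ : 0 ≤ κ := weightedNorm_nonneg hA ν
  set κ' := weightedNorm (fun _ => 1) ξ
  have hκ' : 0 ≤ κ' := weightedNorm_nonneg hA ξ
  obtain ⟨ε, hε, hεη⟩ : ∃ ε : ℝ, 0 < ε ∧ κ * (ε * Q ^ (1 / P)) < η := by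
    have hd : 0 ≤ κ * Q ^ (1 / P) := by positivity
    refine ⟨η / (κ * Q ^ (1 / P) + 1), by positivity, ?_⟩
    rw [mul_left_comm, div_mul_eq_mul_div, div_lt_iff₀ (by positivity)]
    linarith
  obtain ⟨K, hK⟩ := (Real.tendsto_sum_range_one_div_nat_succ_atTop.eventually_gt_atTop
    (M * (κ' * (ε⁻¹ ^ P * Q) ^ (1 / P) + κ * (Q * Q) ^ (1 / P)))).exists
  set F := Finset.range K
  let n : ℕ → ℕ := fun k => 1 * 4 ^ k
  have hn := injective_mul_four_pow one_pos
  have hn2 := injOn_four_pow_sub one_pos F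
  refine ⟨shiftComb p (fun _ => 1) 0 ξ +
    ∑ j ∈ F, ((ε * r j : ℝ) : ℂ) • shiftComb p (fun _ => 1) (-n j) ν, ?_,
    F, fun k => (n k, ((ε * r k : ℝ) : ℂ)⁻¹), fun k => r k * r k,
    κ' * (ε⁻¹ ^ P * Q) ^ (1 / P) + κ * (Q * Q) ^ (1 / P), fun k _ => by
      have := hr k
      positivity, fun θ hθ => (hT.norm_sum_error_le hp hA hA hβ ξ ν F n hn hn2 (fun k => ε * r k)
      (fun k _ => mul_pos hε (hr k)) (fun k => r k * r k) (fun k _ => (mul_pos (hr k) (hr k)).le)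
      θ hθ).trans (add_le_add
        (mul_le_mul_of_nonneg_left (Real.rpow_le_rpow ?_ ?_ ?_) hκ')
        (mul_le_mul_of_nonneg_left (Real.rpow_le_rpow ?_ ?_ ?_) hκ)), ?_⟩
  · rw [dist_eq_norm, add_sub_cancel_left]
    refine (norm_sum_smul_shiftComb_le hp hA hA hβ F (fun j => -(n j : ℤ))
      (fun k _ k' _ h => hn (Int.ofNat_inj.1 (neg_injective h))) _ (fun j => ε * r j)
      (fun j _ => ?_) ν).trans_lt (lt_of_le_of_lt ?_ hεη)
    · rw [Complex.norm_real, Real.norm_of_nonneg (mul_pos hε (hr j)).le]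
    · refine mul_le_mul_of_nonneg_left ?_ hκ
      calc (∑ j ∈ F, (ε * r j * 1) ^ P) ^ (1 / P) = (ε ^ P * ∑ j ∈ F, r j ^ P) ^ (1 / P) := by
            rw [Finset.mul_sum]
            simp only [mul_one, Real.mul_rpow hε.le (hr _).le]
        _ ≤ (ε ^ P * Q) ^ (1 / P) := by
            have h0 : 0 ≤ ∑ j ∈ F, r j ^ P :=
              Finset.sum_nonneg fun k _ => (Real.rpow_pos_of_pos (hr k) _).le
            gcongr
            exact hQ F
        _ = ε * Q ^ (1 / P) := by
            rw [Real.mul_rpow (by positivity) hQ0, one_div, Real.rpow_rpow_inv hε.le hP.ne']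
  · exact Finset.sum_nonneg fun k _ => by
      have := hr k
      positivity
  · calc ∑ k ∈ F, (r k * r k / (ε * r k) * 1) ^ P = ε⁻¹ ^ P * ∑ k ∈ F, r k ^ P := by
          rw [Finset.mul_sum]
          refine Finset.sum_congr rfl fun k _ => ?_
          have := hr k
          rw [← Real.mul_rpow (by positivity) this.le]
          congr 1
          field_simp
      _ ≤ ε⁻¹ ^ P * Q := by
          gcongr
          exact hQ F
  · positivity
  · exact Finset.sum_nonneg fun x _ => by
      have := hr x.1
      have := hr x.2
      positivity
  · calc ∑ x ∈ F.offDiag, (r x.1 * r x.1 / (ε * r x.1) * (ε * r x.2) * 1) ^ P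
        = ∑ x ∈ F.offDiag, r x.1 ^ P * r x.2 ^ P := by
          refine Finset.sum_congr rfl fun x _ => ?_
          have h1 := hr x.1
          have h2 := hr x.2
          rw [← Real.mul_rpow h1.le h2.le]
          congr 1
          field_simp
      _ ≤ ∑ x ∈ F ×ˢ F, r x.1 ^ P * r x.2 ^ P := by
          refine Finset.sum_le_sum_of_subset_of_nonneg (offDiag_subset_product F) fun x _ _ => ?_
          have h1 := hr x.1
          have h2 := hr x.2
          positivity
      _ = (∑ k ∈ F, r k ^ P) * ∑ k ∈ F, r k ^ P := by
          rw [Finset.sum_product, Finset.sum_mul_sum]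
      _ ≤ Q * Q := by
          have h0 : 0 ≤ ∑ j ∈ F, r j ^ P :=
            Finset.sum_nonneg fun k _ => (Real.rpow_pos_of_pos (hr k) _).le
          exact mul_le_mul (hQ F) (hQ F) h0 hQ0
  · positivity
  · rw [Finset.sum_congr rfl fun k _ => hr2 k]
    exact hK

end Unweighted

/-! ### Weights `1` and `2`: counterexample for `p ≥ 2`. -/

section HalvingWeights

/-- The potential equal to `1` on the negative half line and to `2 ^ (-i)` on the positive one. -/
noncomputable def halvingPotential (i : ℤ) : ℂ := ((min 1 ((2 : ℝ) ^ (-i)) : ℝ) : ℂ)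

theorem norm_halvingPotential (i : ℤ) : ‖halvingPotential i‖ = min 1 ((2 : ℝ) ^ (-i)) := by
  rw [halvingPotential, Complex.norm_real, Real.norm_of_nonneg (by positivity)]

theorem halvingPotential_ne_zero (i : ℤ) : halvingPotential i ≠ 0 := by
  rw [← norm_pos_iff, norm_halvingPotential]
  positivity

theorem norm_halvingPotential_le_two_mul (i : ℤ) :
    ‖halvingPotential i‖ ≤ 2 * ‖halvingPotential (i + 1)‖ := by
  rw [norm_halvingPotential, norm_halvingPotential, mul_min_of_nonneg _ _ zero_le_two]
  refine min_le_min (by norm_num) (le_of_eq ?_)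
  rw [neg_add, zpow_add₀ two_ne_zero]
  norm_num
  ring

theorem norm_halvingPotential_sub_le (i m : ℤ) :
    ‖halvingPotential (i - m)‖ ≤ max 1 ((2 : ℝ) ^ (-i)) * min 1 ((2 : ℝ) ^ m) := by
  rw [norm_halvingPotential, mul_min_of_nonneg _ _ (by positivity)]
  refine le_min ((min_le_left _ _).trans (by simp)) ((min_le_right _ _).trans ?_)
  rw [show -(i - m) = -i + m by ring, zpow_add₀ two_ne_zero]
  gcongr
  exact le_max_right _ _

theorem norm_halvingPotential_antitone {i j : ℤ} (h : i ≤ j) :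
    ‖halvingPotential j‖ ≤ ‖halvingPotential i‖ := by
  rw [norm_halvingPotential, norm_halvingPotential]
  exact min_le_min le_rfl (zpow_le_zpow_right₀ one_le_two (by omega))

variable {p : ℝ≥0∞} [Fact (1 ≤ p)]
  {T : lp (fun _ : ℤ => ℂ) p →L[ℂ] lp (fun _ : ℤ => ℂ) p}

/-- All weights have modulus at least one, so the orbit of a nonzero vector stays away from `0`. -/
theorem HasPotential.not_hypercyclic_of_halving (hT : HasPotential T halvingPotential)
    (hp : p ≠ ∞) : ¬ Hypercyclic T := by
  rintro ⟨x, hx⟩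
  have hp0 : p ≠ 0 := (zero_lt_one.trans_le Fact.out).ne'
  obtain ⟨j, hj⟩ : ∃ j, x j ≠ 0 := by
    by_contra! h
    have hx0 : x = 0 := by
      ext j
      exact h j
    obtain ⟨y, ⟨n, rfl⟩, hy⟩ := hx.exists_dist_lt (lp.single p 0 (1 : ℂ)) one_pos
    rw [hx0, map_zero, dist_zero_right, lp.norm_single (zero_lt_one.trans_le Fact.out)] at hy
    simp at hy
  obtain ⟨y, ⟨n, rfl⟩, hy⟩ := hx.exists_dist_lt 0 (norm_pos_iff.2 hj)
  rw [dist_zero_left] at hy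
  have h1 := (lp.norm_apply_le_norm hp0 ((T ^ n) x) (j - n)).trans_lt hy
  rw [hT.pow_apply hp, sub_add_cancel, ← mul_div_assoc, mul_div_right_comm, norm_mul,
    norm_div] at h1
  have h2 : 1 ≤ ‖halvingPotential (j - n)‖ / ‖halvingPotential j‖ :=
    (one_le_div (norm_pos_iff.2 (halvingPotential_ne_zero j))).2
      (norm_halvingPotential_antitone (by omega))
  exact h1.not_ge (le_mul_of_one_le_left (norm_nonneg _) h2)

/-- With `c k = 1` and `a k = 1 / (k + 1)`, the at most `k` cross terms with `j < k` contribute `k *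
a k ^ P ≤ a k`, and those with `j > k` carry a factor `2 ^ (-N)`. The error is thus of order at most
`√H`, against a coefficient sum `H`. -/
theorem HasPotential.weaklyHypercyclic_of_halving (hT : HasPotential T halvingPotential)
    (hp : p ≠ ∞) (hp2 : 2 ≤ p) : WeaklyHypercyclic T := by
  have := separableSpace_lp (p := p) hp
  have hP2 : 2 ≤ p.toReal := by
    simpa using (ENNReal.toReal_le_toReal (by simp) hp).2 hp2
  have hP := toReal_pos_of_ne_top hp
  set P := p.toReal
  suffices h : ∃ x, WeaklyDense (Set.range fun k : ℕ => (T ^ k) x) by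
    obtain ⟨x, hx⟩ := h
    refine ⟨x, ?_⟩
    convert hx using 1
    ext y
    exact ⟨fun ⟨n, h⟩ => ⟨n, h.symm⟩, fun ⟨k, h⟩ => ⟨k, h.symm⟩⟩
  refine exists_weaklyDense_range _ (denseRange_shiftComb hp hT.1) ?_
  rintro _ ⟨ξ, rfl⟩ _ ⟨ν, rfl⟩ η hη M
  let A : ℤ → ℝ := fun i => max 1 (2 ^ (-i))
  let ρ : ℤ → ℝ := fun m => min 1 (2 ^ m)
  have hA : ∀ i, 0 ≤ A i := fun i => zero_le_one.trans (le_max_left _ _)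
  have hρ : ∀ m, 0 ≤ ρ m := fun m => le_min zero_le_one (by positivity)
  have hρ1 : ∀ m, ρ m ≤ 1 := fun m => min_le_left _ _
  have hβ : ∀ i m, ‖halvingPotential (i - m)‖ ≤ A i * ρ m := norm_halvingPotential_sub_le
  have hρN : ∀ (N : ℕ) (m : ℤ), m ≤ -N → ρ m ≤ (1 / 2) ^ N := fun N m h => by
    refine (min_le_right _ _).trans ((zpow_le_zpow_right₀ one_le_two h).trans (le_of_eq ?_))
    rw [zpow_neg, zpow_natCast, one_div, inv_pow]
  have hpow : ∀ {t : ℝ}, 0 ≤ t → t ≤ 1 → t ^ P ≤ t := fun h0 h1 =>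
    Real.rpow_le_self_of_le_one h0 h1 (by linarith)
  set κ := weightedNorm A ν
  have hκ : 0 ≤ κ := weightedNorm_nonneg hA ν
  set κ' := weightedNorm A ξ
  have hκ' : 0 ≤ κ' := weightedNorm_nonneg hA ξ
  -- `K` is fixed first so that `√H` beats `M * (κ' + 2 * κ)`; `N` is chosen afterwards, depending
  -- on `K`.
  obtain ⟨K, hK⟩ := (Real.tendsto_sum_range_one_div_nat_succ_atTop.eventually_gt_atTop
    (max 1 ((M * (κ' + 2 * κ)) ^ 2))).exists
  set F := Finset.range K
  set H := ∑ k ∈ F, 1 / ((k : ℝ) + 1)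
  have hH1 : 1 < H := (le_max_left _ _).trans_lt hK
  have hHM : M * (κ' + 2 * κ) < √H := Real.lt_sqrt_of_sq_lt ((le_max_right _ _).trans_lt hK)
  obtain ⟨N, hN0, hN1, hN2⟩ : ∃ N : ℕ, 0 < N ∧ K * (1 / 2 : ℝ) ^ N ≤ 1 ∧
      κ * (K * (1 / 2 : ℝ) ^ N) ^ (1 / P) < η := by
    have h1 : Filter.Tendsto (fun N : ℕ => K * (1 / 2 : ℝ) ^ N) Filter.atTop (nhds 0) := by
      simpa using (tendsto_pow_atTop_nhds_zero_of_lt_one (r := (1 / 2 : ℝ)) (by norm_num)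
        (by norm_num)).const_mul (K : ℝ)
    have h2 : Filter.Tendsto (fun N : ℕ => κ * (K * (1 / 2 : ℝ) ^ N) ^ (1 / P)) Filter.atTop
        (nhds 0) := by
      have := (h1.rpow_const (p := 1 / P) (Or.inr (by positivity))).const_mul κ
      rwa [Real.zero_rpow (by positivity), mul_zero] at this
    exact ((Filter.eventually_gt_atTop 0).and ((h1.eventually_le_const one_pos).and
      (h2.eventually_lt_const hη))).exists
  let n : ℕ → ℕ := fun k => N * 4 ^ k
  have hn := injective_mul_four_pow hN0
  have hn2 := injOn_four_pow_sub hN0 F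
  have hρn : ∀ j, ρ (-(n j : ℤ)) ≤ (1 / 2) ^ N := fun j => hρN N _ (by
    have : N ≤ n j := Nat.le_mul_of_pos_right N (by positivity)
    omega)
  have hρd : ∀ k j, k < j → ρ ((n k : ℤ) - n j) ≤ (1 / 2) ^ N := fun k j h => hρN N _ (by
    have h1 : 4 * 4 ^ k ≤ 4 ^ j := by
      rw [← pow_succ']
      exact Nat.pow_le_pow_right (by norm_num) h
    have h2 : 1 ≤ 4 ^ k := Nat.one_le_pow _ _ (by norm_num)
    have h3 : n k + N ≤ n j := by
      calc N * 4 ^ k + N = N * (4 ^ k + 1) := by ring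
        _ ≤ N * 4 ^ j := Nat.mul_le_mul_left N (by omega)
    omega)
  have hinv : ∀ k : ℕ, 1 / ((k : ℝ) + 1) ≤ 1 := fun k =>
    (div_le_one (by positivity)).2 (by linarith [(Nat.cast_nonneg k : (0 : ℝ) ≤ k)])
  have hS1 : ∑ k ∈ F, (1 / ((k : ℝ) + 1) / 1 * ρ (n k)) ^ P ≤ H := by
    refine Finset.sum_le_sum fun k _ => ?_
    rw [div_one]
    have h0 : 0 ≤ 1 / ((k : ℝ) + 1) := by positivity
    have h1 := mul_le_of_le_one_right h0 (hρ1 (n k))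
    exact (hpow (mul_nonneg h0 (hρ _)) (h1.trans (hinv k))).trans h1
  have hS2 : ∑ x ∈ F.offDiag, (1 / ((x.1 : ℝ) + 1) / 1 * 1 * ρ (n x.1 - n x.2)) ^ P ≤ 2 * H := by
    have hterm : ∀ x ∈ F.offDiag, (1 / ((x.1 : ℝ) + 1) / 1 * 1 * ρ (n x.1 - n x.2)) ^ P ≤
        (if x.2 < x.1 then (1 / ((x.1 : ℝ) + 1)) ^ 2 else 0) +
          1 / ((x.1 : ℝ) + 1) * (1 / 2) ^ N := by
      rintro ⟨k, j⟩ hx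
      obtain ⟨-, -, hne⟩ := Finset.mem_offDiag.1 hx
      simp only at hne ⊢
      have h0 : 0 ≤ 1 / ((k : ℝ) + 1) := by positivity
      have h1 := mul_le_of_le_one_right h0 (hρ1 ((n k : ℤ) - n j))
      have h2 := mul_nonneg h0 (hρ ((n k : ℤ) - n j))
      rw [div_one, mul_one]
      rcases lt_or_gt_of_ne hne with h | h
      · rw [if_neg h.not_gt, zero_add]
        exact (hpow h2 (h1.trans (hinv k))).trans
          (mul_le_mul_of_nonneg_left (hρd k j h) h0)
      · rw [if_pos h]
        refine le_add_of_le_of_nonneg ((Real.rpow_le_rpow h2 h1 hP.le).trans ?_) (by positivity)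
        rw [← Real.rpow_two]
        exact Real.rpow_le_rpow_of_exponent_ge (by positivity) (hinv k) hP2
    refine (Finset.sum_le_sum hterm).trans ?_
    refine (Finset.sum_le_sum_of_subset_of_nonneg (offDiag_subset_product F)
      fun x _ _ => by positivity).trans ?_
    rw [Finset.sum_product, Finset.mul_sum]
    refine Finset.sum_le_sum fun k _ => ?_
    simp only
    rw [Finset.sum_add_distrib, ← Finset.sum_filter, Finset.sum_const, Finset.sum_const,
      nsmul_eq_mul, nsmul_eq_mul, two_mul, Finset.card_range]
    have h0 : 0 ≤ 1 / ((k : ℝ) + 1) := by positivity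
    refine add_le_add ?_ ?_
    · have hcard : ((F.filter (· < k)).card : ℝ) ≤ k := by
        have : F.filter (· < k) ⊆ Finset.range k := fun j hj =>
          Finset.mem_range.2 (Finset.mem_filter.1 hj).2
        exact_mod_cast (Finset.card_le_card this).trans_eq (Finset.card_range k)
      calc ((F.filter (· < k)).card : ℝ) * (1 / ((k : ℝ) + 1)) ^ 2
          ≤ (k + 1) * (1 / ((k : ℝ) + 1)) ^ 2 := by
            gcongr
            linarith
        _ = 1 / ((k : ℝ) + 1) := by field_simp
    · calc (K : ℝ) * (1 / ((k : ℝ) + 1) * (1 / 2) ^ N)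
          = 1 / ((k : ℝ) + 1) * (K * (1 / 2) ^ N) := by ring
        _ ≤ 1 / ((k : ℝ) + 1) := mul_le_of_le_one_right h0 hN1
  have hroot : ∀ {t : ℝ}, 1 ≤ t → t ^ (1 / P) ≤ √t := fun {t} ht => by
    rw [Real.sqrt_eq_rpow]
    exact Real.rpow_le_rpow_of_exponent_le ht (one_div_le_one_div_of_le two_pos hP2)
  have hR1 : (∑ k ∈ F, (1 / ((k : ℝ) + 1) / 1 * ρ (n k)) ^ P) ^ (1 / P) ≤ √H := by
    refine (Real.rpow_le_rpow (Finset.sum_nonneg fun k _ => ?_) hS1 (by positivity)).trans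
      (hroot hH1.le)
    have := hρ (n k)
    positivity
  have hR2 : (∑ x ∈ F.offDiag, (1 / ((x.1 : ℝ) + 1) / 1 * 1 * ρ (n x.1 - n x.2)) ^ P) ^ (1 / P) ≤
      2 * √H := by
    refine (Real.rpow_le_rpow (Finset.sum_nonneg fun x _ => ?_) hS2 (by positivity)).trans
      ((hroot (by linarith)).trans ?_)
    · have := hρ (n x.1 - n x.2)
      positivity
    · rw [Real.sqrt_mul zero_le_two]
      gcongr
      exact Real.sqrt_le_iff.2 ⟨by norm_num, by norm_num⟩
  refine ⟨shiftComb p halvingPotential 0 ξ + ∑ j ∈ F, ((1 : ℝ) : ℂ) •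
      shiftComb p halvingPotential (-n j) ν, ?_, F, n, fun k => 1 / ((k : ℝ) + 1),
    κ' * √H + κ * (2 * √H), fun k _ => by positivity, fun θ hθ => ?_, ?_⟩
  · rw [dist_eq_norm, add_sub_cancel_left]
    refine (norm_sum_smul_shiftComb_le hp hA hρ hβ F (fun j => -(n j : ℤ))
      (fun k _ k' _ h => hn (Int.ofNat_inj.1 (neg_injective h))) _ (fun _ => 1)
      (fun j _ => by simp) ν).trans_lt (lt_of_le_of_lt ?_ hN2)
    refine mul_le_mul_of_nonneg_left (Real.rpow_le_rpow (Finset.sum_nonneg fun j _ => ?_) ?_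
      (by positivity)) hκ
    · have := hρ (-(n j : ℤ))
      positivity
    · refine (Finset.sum_le_card_nsmul F _ ((1 / 2 : ℝ) ^ N) fun j _ => ?_).trans_eq ?_
      · rw [one_mul]
        exact (hpow (hρ _) (hρ1 _)).trans (hρn j)
      · rw [Finset.card_range, nsmul_eq_mul]
  · have h := hT.norm_sum_error_le hp hA hρ hβ ξ ν F n hn hn2 (fun _ => 1) (fun _ _ => one_pos)
      (fun k => 1 / ((k : ℝ) + 1)) (fun k _ => by positivity) θ hθ
    simp only [Complex.ofReal_one, inv_one, one_smul] at h ⊢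
    refine h.trans (add_le_add (mul_le_mul_of_nonneg_left hR1 hκ')
      (mul_le_mul_of_nonneg_left hR2 hκ))
  · have h0 : 0 < √H := Real.sqrt_pos.2 (by linarith)
    calc M * (κ' * √H + κ * (2 * √H)) = M * (κ' + 2 * κ) * √H := by ring
      _ < √H * √H := mul_lt_mul_of_pos_right hHM h0
      _ = H := Real.mul_self_sqrt (by linarith)

end HalvingWeights

end LinearDynamics

theorem corollary1p7 (p : ℝ≥0∞) [Fact (1 ≤ p)] (hp : p ≠ ∞) :
    ((∀ T : lp (fun _ : ℤ => ℂ) p →L[ℂ] lp (fun _ : ℤ => ℂ) p,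
        LinearDynamics.IsBilateralWeightedShift T →
          LinearDynamics.WeaklyHypercyclic T → LinearDynamics.Hypercyclic T) ↔ p < 2) ∧
    ((∀ T : lp (fun _ : ℤ => ℂ) p →L[ℂ] lp (fun _ : ℤ => ℂ) p,
        LinearDynamics.IsBilateralWeightedShift T →
          LinearDynamics.WeaklySupercyclic T → LinearDynamics.Supercyclic T) ↔ p ≤ 2) := by
  refine ⟨⟨fun h => ?_, fun hp2 T hT hw => ?_⟩, ⟨fun h => ?_, fun hp2 T hT hw => ?_⟩⟩
  · by_contra hp2
    obtain ⟨T, hβ, hT⟩ := LinearDynamics.exists_hasPotential hp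
      LinearDynamics.halvingPotential_ne_zero zero_le_two
      LinearDynamics.norm_halvingPotential_le_two_mul
    exact hβ.not_hypercyclic_of_halving hp
      (h T hT (hβ.weaklyHypercyclic_of_halving hp (not_lt.1 hp2)))
  · obtain ⟨β, hβ, C, hC, hβC⟩ := hT.exists_hasPotential
    exact hβ.hypercyclic hp hC hβC (hβ.exists_lt_of_weaklyHypercyclic hp2 hw)
  · by_contra hp2
    obtain ⟨T, hβ, hT⟩ := LinearDynamics.exists_hasPotential hp (β := fun _ => 1)
      (fun _ => one_ne_zero) zero_le_one (fun _ => by simp)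
    exact hβ.not_supercyclic_of_one hp
      (h T hT (hβ.weaklySupercyclic_of_one hp (not_le.1 hp2)))
  · obtain ⟨β, hβ, C, hC, hβC⟩ := hT.exists_hasPotential
    exact hβ.supercyclic hp hC hβC (hβ.exists_mul_lt_of_weaklySupercyclic hp2 hC hβC hw)
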